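/- Let $N\ge 2$ (the case of the $D_N$ singularity proper being $N\ge 4$), and let $$\Lambda(x,y;u)=\frac{x^{N-1}}{N-1}+xy^2+\sum_{k=1}^{N-1}u_kx^{k-1}+u_Ny,\qquad u=(u_1,\dots,u_N)\in\mathbb C^N,$$ be the unfolding of the $D_N$ singularity. Let $c_{ab}^s(u)$ be the structure constants of the algebra $\mathbb C[x,y]/(\partial_x\Lambda,\partial_y\Lambda)$ in the basis $[\partial\Lambda/\partial u_1],\dots,[\partial\Lambda/\partial u_N]$, and let $\eta(\partial/\partial u_a,\partial/\partial u_b)=c_{ab}^{N-1}(u)$. A holomorphic map $T=(T_1,\dots,T_N):\mathbb C^N\to\mathbb C^N$ with everywhere invertible Jacobian matrix is called a system of normalized flat coordinates if $\eta(\partial/\partial T_\alpha,\partial/\partial T_\beta)$ does not depend on $u$ for all $\alpha,\beta$, $T(0)=0$, and the Jacobian matrix of $T$ at $u=0$ is the identity. There is exactly one system $T$ of normalized flat coordinates. Define the rescaled unfolding coordinates $v_k=u_k/2$ and the rescaled flat coordinates $t_k=T_k(u)/2$, $1\le k\le N$. Then the dependence of the unfolding coordinates on the flat coordinates is $$v_b=\sum_{\substack{\alpha_1,\dots,\alpha_{N-1}\ge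 0\\ \sum_{k=1}^{N-1}(N-k)\alpha_k=N-b}}\frac{(|\alpha|+2b-3)!}{(2b-2)!}\prod_{k=1}^{N-1}\frac{t_k^{\alpha_k}}{\alpha_k!}\quad(1\le b\le N-1),\qquad v_N=t_N,$$ where $|\alpha|=\sum_{k=1}^{N-1}\alpha_k$. More precisely, for all $v,t\in\mathbb C^N$ the following three conditions are equivalent: (i) $t=\tfrac12T(2v)$; (ii) the displayed formulas hold; (iii) $t_N=v_N$ and, for $1\le\gamma\le N-1$, $$t_\gamma=\sum_{\substack{\alpha_1,\dots,\alpha_{N-1}\ge0\\ \sum_{k=1}^{N-1}(N-k)\alpha_k=N-\gamma}}(-1)^{|\alpha|-1}\prod_{k=0}^{|\alpha|-2}\bigl(2\gamma-1+2k(N-1)\bigr)\prod_{k=1}^{N-1}\frac{v_k^{\alpha_k}}{\alpha_k!}.$$ -/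

import Mathlib

/-! Throughout, `N = n + 2`; the index `k = 1, …, N` is represented by `k - 1 : Fin (n + 2)`, the
indices `1, …, N - 1` by `Fin (n + 1)` (embedded by `Fin.castSucc`), and `N` by `Fin.last (n + 1)`. -/

namespace DSing

/-- The monomial multiplying the `k`-th unfolding parameter: `x ^ (k - 1)` for `k = 1, …, N - 1`,
and `y` for `k = N`. The variables are `x = X 0` and `y = X 1`. -/
noncomputable def dirMonomial (n : ℕ) : Fin (n + 2) → MvPolynomial (Fin 2) ℂ :=
  Fin.lastCases (MvPolynomial.X 1) (fun k : Fin (n + 1) => MvPolynomial.X 0 ^ (k : ℕ))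

/-- The unfolding `Λ = x ^ (N - 1) / (N - 1) + x y ^ 2 + ∑ u_k x ^ (k - 1) + u_N y` of the
`D_N` singularity, as a polynomial in `x, y` for fixed parameters `u`.
Thus `∂Λ/∂u_k = dirMonomial n k`. -/
noncomputable def unfolding (n : ℕ) (u : Fin (n + 2) → ℂ) : MvPolynomial (Fin 2) ℂ :=
  MvPolynomial.C (1 / ((n : ℂ) + 1)) * MvPolynomial.X 0 ^ (n + 1)
    + MvPolynomial.X 0 * MvPolynomial.X 1 ^ 2
    + ∑ k, MvPolynomial.C (u k) * dirMonomial n k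

/-- The ideal `(∂Λ/∂x, ∂Λ/∂y)` of `ℂ[x, y]`. -/
noncomputable def jacobianIdeal (n : ℕ) (u : Fin (n + 2) → ℂ) :
    Ideal (MvPolynomial (Fin 2) ℂ) :=
  Ideal.span {MvPolynomial.pderiv 0 (unfolding n u), MvPolynomial.pderiv 1 (unfolding n u)}

/-- The local algebra `ℂ[x, y] / (∂Λ/∂x, ∂Λ/∂y)`. -/
abbrev LocalAlgebra (n : ℕ) (u : Fin (n + 2) → ℂ) : Type :=
  MvPolynomial (Fin 2) ℂ ⧸ jacobianIdeal n u

/-- The class `[∂Λ/∂u_k]` in the local algebra. -/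
noncomputable def dirClass (n : ℕ) (u : Fin (n + 2) → ℂ) (k : Fin (n + 2)) : LocalAlgebra n u :=
  Ideal.Quotient.mk (jacobianIdeal n u) (dirMonomial n k)

/-- `c a b s` are the structure constants of the local algebra at `u` with respect to the classes
`[∂Λ/∂u_1], …, [∂Λ/∂u_N]`. -/
def IsStructureConstants (n : ℕ) (u : Fin (n + 2) → ℂ)
    (c : Fin (n + 2) → Fin (n + 2) → Fin (n + 2) → ℂ) : Prop :=
  ∀ a b, dirClass n u a * dirClass n u b = ∑ s, c a b s • dirClass n u s

/-- `η u a b = η(∂/∂u_a, ∂/∂u_b)` is the pairing on the tangent space at `u`: the structure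
constant `c_{ab}^{N-1}` (the coefficient of `x ^ (N - 2)`). -/
def IsPairing (n : ℕ) (η : (Fin (n + 2) → ℂ) → Matrix (Fin (n + 2)) (Fin (n + 2)) ℂ) : Prop :=
  ∀ u, ∃ c, IsStructureConstants n u c ∧ ∀ a b, η u a b = c a b (Fin.last n).castSucc

/-- The Jacobian matrix `(∂T_α/∂u_a)` at `u`. -/
noncomputable def jacobianMatrix {m : ℕ} (T : (Fin m → ℂ) → (Fin m → ℂ)) (u : Fin m → ℂ) :
    Matrix (Fin m) (Fin m) ℂ :=
  Matrix.of fun α a => fderiv ℂ T u (Pi.single a 1) α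

/-- `T` is a system of flat coordinates for the `D_N` pairing, normalized by `T_k = u_k + …` at
the origin. Since `∂/∂T_α = ∑_a (J⁻¹)_{aα} ∂/∂u_a`, where `J` is the Jacobian matrix of `T`, the
Gram matrix of the pairing in the basis `∂/∂T_1, …, ∂/∂T_N` is `(J⁻¹)ᵀ η J⁻¹`; flatness says that
it does not depend on `u`. -/
structure IsFlatCoordinates (n : ℕ) (T : (Fin (n + 2) → ℂ) → (Fin (n + 2) → ℂ)) : Prop where
  holomorphic : ContDiff ℂ ((⊤ : ℕ∞) : WithTop ℕ∞) T
  coordinates : ∀ u, IsUnit (jacobianMatrix T u).det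
  flat : ∃ η, IsPairing n η ∧ ∃ G : Matrix (Fin (n + 2)) (Fin (n + 2)) ℂ,
    ∀ u, ((jacobianMatrix T u)⁻¹).transpose * η u * (jacobianMatrix T u)⁻¹ = G
  map_zero : T 0 = 0
  jacobian_zero : jacobianMatrix T 0 = 1

/-- The multi-indices `α = (α_1, …, α_{N-1})` with `∑ (N - k) α_k = m`. -/
def multiIndices (n m : ℕ) : Finset (Fin (n + 1) → ℕ) :=
  (Fintype.piFinset fun _ => Finset.range (m + 1)).filter
    fun α => ∑ k : Fin (n + 1), (n + 1 - (k : ℕ)) * α k = m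

theorem mem_multiIndices {n m : ℕ} {α : Fin (n + 1) → ℕ} :
    α ∈ multiIndices n m ↔ ∑ k : Fin (n + 1), (n + 1 - (k : ℕ)) * α k = m := by
  unfold multiIndices
  rw [Finset.mem_filter, Fintype.mem_piFinset]
  refine ⟨fun h => h.2, fun h => ⟨fun k => ?_, h⟩⟩
  have h1 : (n + 1 - (k : ℕ)) * α k ≤ ∑ k : Fin (n + 1), (n + 1 - (k : ℕ)) * α k :=
    Finset.single_le_sum (f := fun k : Fin (n + 1) => (n + 1 - (k : ℕ)) * α k)
      (fun _ _ => Nat.zero_le _) (Finset.mem_univ k)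
  have h2 : 1 ≤ n + 1 - (k : ℕ) := by have := k.isLt; omega
  have h3 : α k ≤ (n + 1 - (k : ℕ)) * α k := Nat.le_mul_of_pos_left _ h2
  exact Finset.mem_range.2 (by omega)

/-- The monomial `∏_{k=1}^{N-1} z_k ^ α_k / α_k!`. -/
noncomputable def dividedMonomial {n : ℕ} (z : Fin (n + 2) → ℂ) (α : Fin (n + 1) → ℕ) : ℂ :=
  ∏ k : Fin (n + 1), z k.castSucc ^ α k / ((α k).factorial : ℂ)

/-- The polynomial
`∑_{∑ (N-k) α_k = N-b} (|α| + 2b - 3)! / (2b - 2)! ∏ t_k ^ α_k / α_k!`, where `1 ≤ b ≤ N - 1`.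
Every `α` in the sum has `|α| ≥ 1`. -/
noncomputable def unfoldingSeries (n : ℕ) (t : Fin (n + 2) → ℂ) (b : Fin (n + 1)) : ℂ :=
  ∑ α ∈ multiIndices n (n + 1 - (b : ℕ)),
    (((∑ k, α k) + 2 * ((b : ℕ) + 1) - 3).factorial : ℂ)
      / ((2 * ((b : ℕ) + 1) - 2).factorial : ℂ) * dividedMonomial t α

/-- The polynomials
`ψ_γ(v) = ∑_{∑ (N-k) α_k = N-γ} (-1) ^ (|α| - 1) ∏_{k=0}^{|α|-2} (2γ - 1 + 2k(N - 1))
  ∏ v_k ^ α_k / α_k!` for `1 ≤ γ ≤ N - 1`, and `ψ_N(v) = v_N`. -/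
noncomputable def psi (n : ℕ) (v : Fin (n + 2) → ℂ) : Fin (n + 2) → ℂ :=
  Fin.lastCases (v (Fin.last (n + 1))) fun γ : Fin (n + 1) =>
    ∑ α ∈ multiIndices n (n + 1 - (γ : ℕ)),
      (-1 : ℂ) ^ ((∑ k, α k) - 1)
        * (∏ k ∈ Finset.range ((∑ k, α k) - 1),
            (2 * (((γ : ℕ) : ℂ) + 1) - 1 + 2 * (k : ℂ) * ((n : ℂ) + 1)))
        * dividedMonomial v α

end DSing

/-! The pairing is a residue. On the curve ∂Λ/∂y = 2xy + u_N = 0 the residues at the critical points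
can be moved to the ends x = ∞ and y = ∞, so `residue` is the difference of the constant terms of
q/∂_xΛ at these ends. It kills the Jacobian ideal and reads off the coefficient of x^(N-2), hence
η_ab = residue(φ_a φ_b) with φ_a = ∂Λ/∂u_a. On the powers of x, η is a Hankel matrix in the
coefficients of 1/F, where F is x^(-(N-2)) ∂_xΛ expanded in s = 1/x; its inverse is Hankel in the
coefficients of F.

Put c = 2(N-1), v = u/2, g = ∑ v_k s^(N-k), and write P^q for (1 + c g)^(q/c) (`rootPow`). Then F =
P^c (1 - 2sP'/P) modulo s^N (`curveSeries_eq`). The candidate T_γ = 2/(2m-1) [s^m] P^(2m-1), m =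
N-γ, has Jacobian entries [s^(a-γ)] P^(-(2γ-1)). Thus J η⁻¹ Jᵀ has entries [s^k] P^(2k) (1 - 2sP'/P)
with k = N-α-β, which are 1 for k = 0 and 0 otherwise (`coeff_rootPow_mul_jacFactor`), so T is flat.

Two normalized flat systems differ by a holomorphic isometry of a constant nondegenerate form; such
a map is affine, hence the identity by the normalization (`eq_id_of_isometry`).

For the inversion put σ = s P^(-2). Lagrange inversion gives P^(-1) = 1 - A(σ), where A has
coefficients ψ_γ at σ^(N-γ), and v_b = [σ^(N-b)] of the primitive of A' (1-A)^(-(2b-1)), which is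
the stated polynomial (`unfoldingSeries_psi`). Triangularity of these polynomials gives the converse
(`eq_psi_iff`). -/

namespace DSing
open PowerSeries Finset

/-! ### Formal complex powers of 1 + cX and of 1 + cg. -/

/-- The series `(1 + c X) ^ (-p / c)`. -/
noncomputable def binomSeries (c p : ℂ) : PowerSeries ℂ :=
  PowerSeries.mk fun r => (-1) ^ r * (∏ k ∈ range r, (p + k * c)) / (r.factorial : ℂ)

theorem coeff_binomSeries (c p : ℂ) (r : ℕ) :
    coeff r (binomSeries c p) = (-1) ^ r * (∏ k ∈ range r, (p + k * c)) / (r.factorial : ℂ) :=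
  coeff_mk _ _

theorem binomSeries_ode (c p : ℂ) :
    (1 + C c * X) * derivative ℂ (binomSeries c p) = -(C p * binomSeries c p) := by
  ext r
  have h : ∀ r : ℕ, ((r : ℂ) + 1) * coeff (r + 1) (binomSeries c p)
      = -(p + r * c) * coeff r (binomSeries c p) := by
    intro r
    rw [coeff_binomSeries, coeff_binomSeries, prod_range_succ, Nat.factorial_succ]
    have : (r.factorial : ℂ) ≠ 0 := by exact_mod_cast r.factorial_ne_zero
    have : (r : ℂ) + 1 ≠ 0 := by exact_mod_cast r.succ_ne_zero
    push_cast
    generalize ∏ k ∈ range r, (p + k * c) = P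
    field_simp
    ring
  rw [add_mul, one_mul, mul_assoc, map_add, map_neg, coeff_C_mul, coeff_C_mul, coeff_derivative]
  cases r with
  | zero =>
    have := h 0
    simp only [coeff_zero_X_mul]
    push_cast at this ⊢
    linear_combination this
  | succ r =>
    have := h (r + 1)
    rw [coeff_succ_X_mul, coeff_derivative]
    push_cast at this ⊢
    linear_combination this

/-- The equation is a recursion that determines every coefficient from the constant term. The
exponent laws below follow by checking that both sides solve it. -/
theorem eq_of_linear_ode {c p : ℂ} {Y Z : PowerSeries ℂ}
    (h0 : constantCoeff Y = constantCoeff Z)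
    (hY : (1 + C c * X) * derivative ℂ Y = -(C p * Y))
    (hZ : (1 + C c * X) * derivative ℂ Z = -(C p * Z)) : Y = Z := by
  have key : ∀ W : PowerSeries ℂ, (1 + C c * X) * derivative ℂ W = -(C p * W) →
      ∀ r : ℕ, ((r : ℂ) + 1) * coeff (r + 1) W = -(p + r * c) * coeff r W := by
    intro W hW r
    have := congrArg (coeff r) hW
    rw [add_mul, one_mul, mul_assoc, map_add, map_neg, coeff_C_mul, coeff_C_mul,
      coeff_derivative] at this
    cases r with
    | zero =>
      simp only [coeff_zero_X_mul] at this
      push_cast at this ⊢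
      linear_combination this
    | succ r =>
      rw [coeff_succ_X_mul, coeff_derivative] at this
      push_cast at this ⊢
      linear_combination this
  ext r
  induction r with
  | zero => simpa using h0
  | succ r ih =>
    have : (r : ℂ) + 1 ≠ 0 := by exact_mod_cast r.succ_ne_zero
    apply mul_left_cancel₀ this
    rw [key Y hY, key Z hZ, ih]

@[simp] theorem constantCoeff_binomSeries (c p : ℂ) : constantCoeff (binomSeries c p) = 1 := by
  rw [← coeff_zero_eq_constantCoeff_apply, coeff_binomSeries]
  simp

theorem binomSeries_zero (c : ℂ) : binomSeries c 0 = 1 := by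
  apply eq_of_linear_ode (c := c) (p := 0) (by simp) (binomSeries_ode c 0)
  rw [show (1 : PowerSeries ℂ) = C 1 by simp, derivative_C]
  simp

theorem binomSeries_neg (c : ℂ) : binomSeries c (-c) = 1 + C c * X := by
  apply eq_of_linear_ode (c := c) (p := -c) (by simp) (binomSeries_ode c _)
  rw [map_add, Derivation.leibniz, derivative_one, derivative_C, derivative_X]
  simp
  ring

theorem binomSeries_add (c p q : ℂ) :
    binomSeries c (p + q) = binomSeries c p * binomSeries c q := by
  apply eq_of_linear_ode (c := c) (p := p + q) (by simp) (binomSeries_ode c _)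
  rw [Derivation.leibniz]
  have h1 := binomSeries_ode c p
  have h2 := binomSeries_ode c q
  simp only [smul_eq_mul, map_add]
  linear_combination binomSeries c p * h2 + binomSeries c q * h1

/-- The series `(1 + c g) ^ (q / c)`. -/
noncomputable def rootPow (c : ℂ) (g : PowerSeries ℂ) (q : ℂ) : PowerSeries ℂ :=
  (binomSeries c (-q)).subst g

/-- The logarithmic derivative of `(1 + c g) ^ (1 / c)`. -/
noncomputable def rootLogDeriv (c : ℂ) (g : PowerSeries ℂ) : PowerSeries ℂ :=
  derivative ℂ g * rootPow c g (-c)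

theorem hasSubst {g : PowerSeries ℂ} (hg : constantCoeff g = 0) : HasSubst g :=
  HasSubst.of_constantCoeff_zero' hg

theorem subst_one_eq {g : PowerSeries ℂ} (hg : constantCoeff g = 0) :
    (1 : PowerSeries ℂ).subst g = (1 : PowerSeries ℂ) := by
  rw [← coe_substAlgHom (hasSubst hg), map_one]

theorem subst_C_eq (g : PowerSeries ℂ) (r : ℂ) :
    (C r).subst g = (C r : PowerSeries ℂ) := subst_C r

section
variable {c : ℂ} {g : PowerSeries ℂ} (hg : constantCoeff g = 0)
include hg

theorem rootPow_add (p q : ℂ) : rootPow c g (p + q) = rootPow c g p * rootPow c g q := by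
  rw [rootPow, neg_add, binomSeries_add, subst_mul (hasSubst hg)]; rfl

theorem rootPow_zero : rootPow c g 0 = 1 := by
  rw [rootPow, neg_zero, binomSeries_zero, subst_one_eq hg]

theorem rootPow_self : rootPow c g c = 1 + C c * g := by
  rw [rootPow, binomSeries_neg, subst_add (hasSubst hg), subst_mul (hasSubst hg),
    subst_X (hasSubst hg), subst_one_eq hg, subst_C_eq]

theorem rootPow_mul_neg (q : ℂ) : rootPow c g q * rootPow c g (-q) = 1 := by
  rw [← rootPow_add hg, add_neg_cancel, rootPow_zero hg]

theorem rootPow_natCast_mul (q : ℂ) (k : ℕ) : rootPow c g (k * q) = rootPow c g q ^ k := by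
  induction k with
  | zero => simp [rootPow_zero hg]
  | succ k ih => rw [Nat.cast_succ, add_mul, one_mul, rootPow_add hg, ih, pow_succ]

theorem derivative_rootPow (q : ℂ) :
    derivative ℂ (rootPow c g q) = C q * rootLogDeriv c g * rootPow c g q := by
  have h1 : (1 + C c * g) * rootPow c g (-c) = 1 := by
    rw [← rootPow_self hg, rootPow_mul_neg hg]
  have h2 := congrArg (subst g) (binomSeries_ode c (-q))
  rw [subst_mul (hasSubst hg), ← neg_mul, subst_mul (hasSubst hg), ← map_neg, neg_neg,
    subst_C_eq, subst_add (hasSubst hg),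
    subst_mul (hasSubst hg), subst_X (hasSubst hg), subst_one_eq hg, subst_C_eq] at h2
  rw [rootPow, derivative_subst (hasSubst hg), rootLogDeriv]
  linear_combination derivative ℂ g * rootPow c g (-c) * h2 -
    derivative ℂ g * (subst g (derivative ℂ (binomSeries c (-q)))) * h1

theorem constantCoeff_rootPow (q : ℂ) : constantCoeff (rootPow c g q) = 1 := by
  have := constantCoeff_subst_eq_zero (R := ℂ) hg (binomSeries c (-q) - 1) (by simp)
  rw [subst_sub (hasSubst hg), subst_one_eq hg] at this
  have h2 : constantCoeff (rootPow c g q - 1) = 0 := this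
  rw [map_sub, map_one, sub_eq_zero] at h2
  exact h2

end

/-! ### The change of variable σ = s P^(-2) and Lagrange inversion. -/

theorem coeff_X_mul_derivative (f : PowerSeries ℂ) (k : ℕ) :
    coeff k (X * derivative ℂ f) = k * coeff k f := by
  cases k with
  | zero => simp
  | succ k => rw [coeff_succ_X_mul, coeff_derivative]; push_cast; ring

theorem X_pow_dvd_pow {g : PowerSeries ℂ} (hg : constantCoeff g = 0) (k : ℕ) : X ^ k ∣ g ^ k :=
  pow_dvd_pow_of_dvd (X_dvd_iff.2 hg) k

/-- Powers of `g` beyond the `M`-th are divisible by X^(M+1), so the substitution is a finite sum as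
far as one coefficient is concerned. -/
theorem coeff_mul_subst {g : PowerSeries ℂ} (hg : constantCoeff g = 0) (h Y : PowerSeries ℂ)
    (M : ℕ) : coeff M (h * Y.subst g) = ∑ i ∈ range (M + 1), coeff i Y * coeff M (h * g ^ i) := by
  have hY : Y = (trunc (M + 1) Y : PowerSeries ℂ)
      + X ^ (M + 1) * PowerSeries.mk fun i => coeff (M + 1 + i) Y := by
    ext i
    rw [map_add, Polynomial.coeff_coe, coeff_trunc, coeff_X_pow_mul', coeff_mk]
    by_cases hi : i < M + 1
    · simp [hi, Nat.not_lt.2 (Nat.lt_succ_iff.1 hi)]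
    · rw [if_neg hi, if_pos (by omega)]; simp; congr 1; congr 1; omega
  have h1 : coeff M
      (h * (X ^ (M + 1) * PowerSeries.mk fun i => coeff (M + 1 + i) Y).subst g) = 0 := by
    rw [subst_mul (hasSubst hg), subst_pow (hasSubst hg), subst_X (hasSubst hg)]
    have : X ^ (M + 1) ∣
        h * (g ^ (M + 1) * (PowerSeries.mk fun i => coeff (M + 1 + i) Y).subst g) :=
      Dvd.dvd.mul_left (Dvd.dvd.mul_right (X_pow_dvd_pow hg _) _) _
    exact X_pow_dvd_iff.1 this M (Nat.lt_succ_self M)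
  conv_lhs => rw [hY]
  rw [subst_add (hasSubst hg), mul_add, map_add, h1, add_zero, subst_coe (hasSubst hg),
    Polynomial.aeval_eq_sum_range' (n := M + 1) ((natDegree_trunc_lt Y M)), mul_sum, map_sum]
  refine sum_congr rfl fun i hi => ?_
  rw [mul_smul_comm, coeff_smul, coeff_trunc, if_pos (mem_range.1 hi), smul_eq_mul]

theorem coeff_subst_eq_sum {g : PowerSeries ℂ} (hg : constantCoeff g = 0) (Y : PowerSeries ℂ)
    (M : ℕ) : coeff M (Y.subst g : PowerSeries ℂ)
      = ∑ i ∈ range (M + 1), coeff i Y * coeff M (g ^ i) := by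
  simpa using coeff_mul_subst hg 1 Y M

/-- The logarithmic derivative factor `σ'(s) s / σ(s)` of `σ = s (1 + c g) ^ (-2 / c)`. -/
noncomputable def jacFactor (c : ℂ) (g : PowerSeries ℂ) : PowerSeries ℂ :=
  1 - C 2 * (X * rootLogDeriv c g)

/-- The change of variable `σ = s (1 + c g) ^ (-2 / c)`. -/
noncomputable def changeVar (c : ℂ) (g : PowerSeries ℂ) : PowerSeries ℂ :=
  X * rootPow c g (-2)

theorem constantCoeff_changeVar (c : ℂ) (g : PowerSeries ℂ) :
    constantCoeff (changeVar c g) = 0 := by simp [changeVar]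

section
variable {c : ℂ} {g : PowerSeries ℂ} (hg : constantCoeff g = 0)
include hg

theorem coeff_rootPow_mul_logDeriv (q : ℂ) (k : ℕ) :
    q * coeff k (rootPow c g q * (X * rootLogDeriv c g)) = k * coeff k (rootPow c g q) := by
  rw [← coeff_X_mul_derivative, derivative_rootPow hg, ← coeff_C_mul]
  congr 1
  ring

/-- For k > 0 the product is P^(2k) - (s/k)(P^(2k))', whose s^k coefficient cancels: the residue of
dσ/σ^(k+1). Both Lagrange inversion and flatness rest on this. -/
theorem coeff_rootPow_mul_jacFactor (k : ℕ) :
    coeff k (rootPow c g (2 * k) * jacFactor c g) = if k = 0 then 1 else 0 := by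
  split_ifs with hk
  · subst hk
    simp [rootPow_zero hg, jacFactor]
  · have := coeff_rootPow_mul_logDeriv (c := c) hg (2 * k) k
    have hk' : (k : ℂ) ≠ 0 := by exact_mod_cast hk
    rw [jacFactor, mul_sub, mul_one, map_sub, mul_left_comm, coeff_C_mul]
    apply mul_left_cancel₀ hk'
    linear_combination -this

theorem changeVar_pow (i : ℕ) : changeVar c g ^ i = X ^ i * rootPow c g (-(2 * i)) := by
  rw [changeVar, mul_pow, ← rootPow_natCast_mul hg]
  congr 2
  ring

/-- This is the residue of Y(σ) dσ/σ^(M+1) computed in s, since σ^(-M) = s^(-M) P^(2M) and dσ/σ is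
`jacFactor` times ds/s. -/
theorem coeff_extract (Y : PowerSeries ℂ) (M : ℕ) :
    coeff M (rootPow c g (2 * M) * jacFactor c g * Y.subst (changeVar c g)) = coeff M Y := by
  rw [coeff_mul_subst (constantCoeff_changeVar c g), sum_eq_single_of_mem M (by simp)]
  · rw [changeVar_pow hg, mul_left_comm, coeff_X_pow_mul', if_pos le_rfl, mul_right_comm,
      rootPow_mul_neg hg, one_mul]
    simp [jacFactor]
  · intro i hi hne
    have hi : i < M := by have := mem_range.1 hi; omega
    rw [changeVar_pow hg, mul_left_comm, coeff_X_pow_mul', if_pos hi.le, mul_right_comm,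
      ← rootPow_add hg, show (2 * (M : ℂ) + -(2 * i)) = 2 * ((M - i : ℕ) : ℂ) by
        rw [Nat.cast_sub hi.le]; ring, coeff_rootPow_mul_jacFactor hg, if_neg (by omega), mul_zero]

/-- Both factors have constant term 1, so the lowest coefficient of `Z` survives unchanged in the
extraction of its own degree. -/
theorem eq_zero_of_coeff_extract {Z : PowerSeries ℂ}
    (h : ∀ M, coeff M (rootPow c g (2 * M) * jacFactor c g * Z) = 0) : Z = 0 := by
  ext M
  rw [map_zero]
  induction M using Nat.strong_induction_on with
  | _ M ih =>
    have hd : X ^ M ∣ Z := X_pow_dvd_iff.2 fun m hm => ih m hm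
    obtain ⟨W, rfl⟩ := hd
    have := h M
    rw [mul_left_comm, coeff_X_pow_mul', if_pos le_rfl, Nat.sub_self,
      coeff_zero_eq_constantCoeff_apply, map_mul, map_mul, constantCoeff_rootPow hg] at this
    rw [coeff_X_pow_mul', if_pos le_rfl, Nat.sub_self, coeff_zero_eq_constantCoeff_apply]
    simpa [jacFactor] using this

omit hg in
/-- The series `A` with `(1 + c g) ^ (-1 / c) = 1 - A(σ)`. -/
noncomputable def inverseSeries (c : ℂ) (g : PowerSeries ℂ) : PowerSeries ℂ :=
  PowerSeries.mk fun M => if M = 0 then 0 else coeff M (rootPow c g (2 * M - 1)) / (2 * M - 1)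

omit hg in
theorem two_mul_sub_one_ne_zero (M : ℕ) : (2 * (M : ℂ) - 1) ≠ 0 := by
  intro h
  have h1 : ((2 * M : ℕ) : ℂ) = (1 : ℕ) := by push_cast; linear_combination h
  have := Nat.cast_injective h1
  omega

omit hg in
theorem constantCoeff_inverseSeries : constantCoeff (inverseSeries c g) = 0 := by
  rw [← coeff_zero_eq_constantCoeff_apply, inverseSeries, coeff_mk, if_pos rfl]

/-- Both sides have the same extractions: for M > 0, [s^M] P^(2M-1) (1 - 2sP'/P) = -[s^M] P^(2M-1) /
(2M-1). In degree 0 the default value 0 is the constant term of 1 - P^(-1). -/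
theorem inverseSeries_subst :
    (inverseSeries c g).subst (changeVar c g) = 1 - rootPow c g (-1) := by
  rw [← sub_eq_zero]
  apply eq_zero_of_coeff_extract (c := c) hg
  intro M
  rw [mul_sub, map_sub, coeff_extract hg, mul_sub, map_sub, mul_one, coeff_rootPow_mul_jacFactor hg,
    mul_right_comm, ← rootPow_add hg, ← sub_eq_add_neg, inverseSeries, coeff_mk]
  have := coeff_rootPow_mul_logDeriv (c := c) hg (2 * M - 1) M
  have h0 := two_mul_sub_one_ne_zero M
  have h2 : (2 * (M : ℂ) - 1) * coeff M (rootPow c g (2 * M - 1) * jacFactor c g)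
      = - coeff M (rootPow c g (2 * M - 1)) := by
    rw [jacFactor, mul_sub, mul_one, map_sub, mul_left_comm, coeff_C_mul]
    linear_combination -2 * this
  split_ifs with hM
  · subst hM
    simp [constantCoeff_rootPow hg, jacFactor]
  · apply mul_left_cancel₀ h0
    rw [mul_sub, mul_sub, mul_div_cancel₀ _ h0, h2]
    ring

omit hg in
theorem binomSeries_neg_one_mul (q : ℕ) : binomSeries (-1) (-q) * (1 - X) ^ q = 1 := by
  have h1 : ∀ q : ℕ, binomSeries (-1) q = (1 - X) ^ q := by
    intro q
    induction q with
    | zero => simp [binomSeries_zero]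
    | succ q ih =>
      rw [Nat.cast_succ, binomSeries_add, ih, pow_succ]
      congr 1
      have := binomSeries_neg (-1)
      rw [neg_neg] at this
      rw [this]
      simp
      ring
  rw [← h1, ← binomSeries_add, neg_add_cancel, binomSeries_zero]

theorem binomSeries_subst_inverseSeries (q : ℕ) :
    PowerSeries.subst (changeVar c g)
      ((binomSeries (-1) (-q)).subst (inverseSeries c g) : PowerSeries ℂ) = rootPow c g q := by
  have hA := hasSubst (constantCoeff_inverseSeries (c := c) (g := g))
  have hσ := hasSubst (constantCoeff_changeVar c g)
  have h0 : constantCoeff (1 - rootPow c g (-1)) = 0 := by simp [constantCoeff_rootPow hg]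
  rw [subst_comp_subst_apply hA hσ, inverseSeries_subst hg]
  have := congrArg (subst (1 - rootPow c g (-1))) (binomSeries_neg_one_mul q)
  rw [subst_mul (hasSubst h0), subst_pow (hasSubst h0), subst_sub (hasSubst h0), subst_one_eq h0,
    subst_X (hasSubst h0), sub_sub_cancel, ← rootPow_natCast_mul hg, mul_neg_one] at this
  have h2 := rootPow_mul_neg (c := c) hg q
  linear_combination rootPow c g q * this
    - subst (1 - rootPow c g (-1)) (binomSeries (-1) (-q)) * h2

/-- Differentiating A(σ) = 1 - P^(-1) gives A'(σ) σ' = P^(-1) P'/P, and sσ' is σ times `jacFactor`.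
-/
theorem logDeriv_eq_subst : X * rootLogDeriv c g
    = rootPow c g 1 * (X * derivative ℂ (inverseSeries c g)).subst (changeVar c g)
      * jacFactor c g := by
  have hσ := hasSubst (constantCoeff_changeVar c g)
  have h1 := congrArg (derivative ℂ) (inverseSeries_subst (c := c) hg)
  rw [derivative_subst hσ, changeVar, Derivation.leibniz, map_sub, derivative_one,
    derivative_rootPow hg, derivative_rootPow hg, derivative_X, ← changeVar] at h1
  have h2 := rootPow_mul_neg (c := c) hg 1
  rw [subst_mul hσ, subst_X hσ]
  simp only [smul_eq_mul, mul_one, zero_sub, map_neg, map_one] at h1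
  rw [jacFactor]
  rw [changeVar] at h1 ⊢
  linear_combination -X * rootPow c g 1 * h1 - X * rootLogDeriv c g * h2

/-- Lagrange inversion. -/
theorem coeff_eq_coeff_inverseSeries {m b : ℕ} (hc : c = 2 * m + 2 * b) :
    (m : ℂ) * coeff m g = coeff m (X * derivative ℂ (inverseSeries c g) *
      (binomSeries (-1) (-(2 * b + 1 : ℕ))).subst (inverseSeries c g)) := by
  have hσ := hasSubst (constantCoeff_changeVar c g)
  rw [← coeff_X_mul_derivative, ← coeff_extract (c := c) hg (X * derivative ℂ (inverseSeries c g) * _) m,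
    subst_mul hσ, binomSeries_subst_inverseSeries hg]
  congr 1
  have h1 : rootLogDeriv c g * rootPow c g c = derivative ℂ g := by
    rw [rootLogDeriv, mul_assoc, mul_comm (rootPow c g (-c)), rootPow_mul_neg hg, mul_one]
  -- Here the value of `c` enters: P^(2m) is the extraction factor, while P^(2b) and the factor P of
  -- `logDeriv_eq_subst` make up (1-A)^(-(2b+1)).
  have h2 : rootPow c g c = rootPow c g (2 * m) * rootPow c g (2 * b) := by
    rw [← rootPow_add hg, hc]
  have h3 : rootPow c g ((2 * b + 1 : ℕ) : ℂ) = rootPow c g (2 * b) * rootPow c g 1 := by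
    rw [← rootPow_add hg]; push_cast; rfl
  rw [h3, ← h1, h2]
  linear_combination rootPow c g (2 * m) * rootPow c g (2 * b) * logDeriv_eq_subst (c := c) hg

end

/-! ### Multi-index sums as coefficients, and inversion of the explicit formulas. -/

/-- The polynomial `∑ z_k s ^ (N - k)`, the sum being over `1 ≤ k ≤ N - 1`. -/
noncomputable def genPoly {n : ℕ} (z : Fin (n + 2) → ℂ) : PowerSeries ℂ :=
  ∑ k : Fin (n + 1), C (z k.castSucc) * X ^ (n + 1 - (k : ℕ))

@[simp] theorem constantCoeff_genPoly {n : ℕ} (z : Fin (n + 2) → ℂ) :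
    constantCoeff (genPoly z) = 0 := by
  rw [genPoly, map_sum]
  refine sum_eq_zero fun k _ => ?_
  have : n + 1 - (k : ℕ) ≠ 0 := by omega
  simp [this]

theorem coeff_genPoly {n : ℕ} (z : Fin (n + 2) → ℂ) (k : Fin (n + 1)) :
    coeff (n + 1 - (k : ℕ)) (genPoly z) = z k.castSucc := by
  rw [genPoly, map_sum, sum_eq_single k]
  · simp [coeff_X_pow]
  · intro j _ hj
    have : n + 1 - (k : ℕ) ≠ n + 1 - (j : ℕ) := fun h => hj (Fin.ext (by omega))
    simp [coeff_X_pow, this]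
  · simp

/-- The multinomial theorem, with the multi-indices grouped by |α| = r. -/
theorem sum_multiIndices {n : ℕ} (z : Fin (n + 2) → ℂ) (m : ℕ) (f : ℕ → ℂ) :
    ∑ α ∈ multiIndices n m, f (∑ k, α k) * dividedMonomial z α
      = ∑ r ∈ range (m + 1), f r / (r.factorial : ℂ) * coeff m (genPoly z ^ r) := by
  have hmaps : ∀ α ∈ multiIndices n m, (∑ k, α k) ∈ range (m + 1) := by
    intro α hα
    rw [mem_multiIndices] at hα
    rw [mem_range, Nat.lt_succ_iff, ← hα]
    refine sum_le_sum fun k _ => Nat.le_mul_of_pos_left _ (by omega)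
  rw [← sum_fiberwise_of_maps_to hmaps]
  refine sum_congr rfl fun r _ => ?_
  have hfil : {α ∈ multiIndices n m | ∑ k, α k = r}
      = {α ∈ piAntidiag (univ : Finset (Fin (n + 1))) r |
          m = ∑ k : Fin (n + 1), (n + 1 - (k : ℕ)) * α k} := by
    ext α
    simp only [mem_filter, mem_multiIndices, mem_piAntidiag, mem_univ, implies_true, and_true]
    exact ⟨fun h => ⟨h.2, h.1.symm⟩, fun h => ⟨h.2.symm, h.1⟩⟩
  rw [hfil, genPoly, sum_pow_eq_sum_piAntidiag, map_sum, mul_sum, sum_filter]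
  refine sum_congr rfl fun α hα => ?_
  have hr : ∑ k, α k = r := (mem_piAntidiag.1 hα).1
  have h1 : ∏ k : Fin (n + 1), (C (z k.castSucc) * X ^ (n + 1 - (k : ℕ)) : PowerSeries ℂ) ^ α k
      = C (∏ k : Fin (n + 1), z k.castSucc ^ α k)
        * X ^ (∑ k : Fin (n + 1), (n + 1 - (k : ℕ)) * α k) := by
    simp_rw [mul_pow, prod_mul_distrib, ← pow_mul, prod_pow_eq_pow_sum, map_prod, map_pow]
  rw [h1, ← map_natCast (C (R := ℂ)), coeff_C_mul, coeff_C_mul, coeff_X_pow]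
  split_ifs with hm
  · have h2 := Nat.multinomial_spec univ α
    rw [hr] at h2
    have h3 : (∏ k, ((α k).factorial : ℂ)) * (Nat.multinomial univ α : ℂ) = (r.factorial : ℂ) := by
      exact_mod_cast h2
    have h4 : (∏ k, ((α k).factorial : ℂ)) ≠ 0 :=
      prod_ne_zero_iff.2 fun k _ => by exact_mod_cast (α k).factorial_ne_zero
    have h5 : (r.factorial : ℂ) ≠ 0 := by exact_mod_cast r.factorial_ne_zero
    rw [dividedMonomial, prod_div_distrib, hr]
    field_simp
    rw [← h3]
    ring
  · simp

theorem psi_castSucc_mul {n : ℕ} (v : Fin (n + 2) → ℂ) (γ : Fin (n + 1)) {m : ℕ}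
    (hm : m + γ = n + 1) :
    (2 * (m : ℂ) - 1) * psi n v γ.castSucc
      = coeff m (rootPow (2 * (n + 1)) (genPoly v) (2 * m - 1)) := by
  have hm' : n + 1 - (γ : ℕ) = m := by omega
  have hmC : (m : ℂ) + (γ : ℕ) = n + 1 := by exact_mod_cast hm
  rw [rootPow, coeff_subst_eq_sum (constantCoeff_genPoly v), psi, Fin.lastCases_castSucc, hm',
    sum_multiIndices v m fun r => (-1 : ℂ) ^ (r - 1) * ∏ k ∈ range (r - 1),
      (2 * (((γ : ℕ) : ℂ) + 1) - 1 + 2 * (k : ℂ) * ((n : ℂ) + 1)), mul_sum]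
  refine sum_congr rfl fun r _ => ?_
  cases r with
  | zero =>
    -- The truncated `r - 1` leaves a spurious factor at `r = 0`, harmless because 1 has no
    -- coefficient in degree m > 0.
    have : m ≠ 0 := by omega
    simp [coeff_one, this]
  | succ r =>
    rw [coeff_binomSeries, prod_range_succ']
    -- The factor at index 0, split off just before, matches the 2m-1 of the left side up to sign;
    -- the shifted factors are those of `psi`.
    have : ∀ k : ℕ, -(2 * (m : ℂ) - 1) + (k + 1 : ℕ) * (2 * ((n : ℂ) + 1))
        = 2 * (((γ : ℕ) : ℂ) + 1) - 1 + 2 * (k : ℂ) * ((n : ℂ) + 1) := by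
      intro k
      push_cast
      linear_combination -2 * hmC
    simp_rw [this]
    simp only [Nat.add_sub_cancel, pow_succ]
    push_cast
    ring

theorem coeff_inverseSeries_eq_psi {n : ℕ} (v : Fin (n + 2) → ℂ) {i : ℕ} (hi : i < n + 2) :
    coeff i (genPoly (psi n v)) = coeff i (inverseSeries (2 * (n + 1)) (genPoly v)) := by
  rw [inverseSeries, coeff_mk]
  split_ifs with h0
  · subst h0
    simp
  · have h := coeff_genPoly (psi n v) ⟨n + 1 - i, by omega⟩
    have h1 : n + 1 - (n + 1 - i) = i := by omega
    simp only [h1] at h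
    have h2 := psi_castSucc_mul v ⟨n + 1 - i, by omega⟩ (m := i) (by simp; omega)
    rw [h, eq_div_iff (two_mul_sub_one_ne_zero i), mul_comm, h2]

/-- `∑ (r + 2b - 1)! / (2b)! X ^ r / r!`, the sum being over `r ≥ 1`. -/
noncomputable def unfoldingKernel (b : ℕ) : PowerSeries ℂ :=
  PowerSeries.mk fun r => if r = 0 then 0 else
    ((r + 2 * b - 1).factorial : ℂ) / ((2 * b).factorial : ℂ) / (r.factorial : ℂ)

theorem derivative_unfoldingKernel (b : ℕ) :
    derivative ℂ (unfoldingKernel b) = binomSeries (-1) (-(2 * b + 1 : ℕ)) := by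
  ext r
  rw [coeff_derivative, unfoldingKernel, coeff_mk, if_neg (Nat.succ_ne_zero r), coeff_binomSeries]
  have hprod : (-1 : ℂ) ^ r * ∏ k ∈ range r, (-((2 * b + 1 : ℕ) : ℂ) + k * (-1))
      = ((r + 2 * b).factorial : ℂ) / ((2 * b).factorial : ℂ) := by
    have : ((2 * b).factorial : ℂ) ≠ 0 := by exact_mod_cast (2 * b).factorial_ne_zero
    rw [eq_div_iff this]
    induction r with
    | zero => simp
    | succ r ih =>
      rw [prod_range_succ, show r + 1 + 2 * b = (r + 2 * b) + 1 by ring, Nat.factorial_succ]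
      push_cast at ih ⊢
      rw [← ih, pow_succ]
      ring
  rw [hprod, show r + 1 + 2 * b - 1 = r + 2 * b by omega, Nat.factorial_succ]
  have : (r : ℂ) + 1 ≠ 0 := by exact_mod_cast r.succ_ne_zero
  push_cast
  field_simp

theorem unfoldingSeries_eq_coeff {n : ℕ} (t : Fin (n + 2) → ℂ) (b : Fin (n + 1)) {m : ℕ}
    (hm : m + b = n + 1) :
    unfoldingSeries n t b = coeff m ((unfoldingKernel b).subst (genPoly t) : PowerSeries ℂ) := by
  have hm' : n + 1 - (b : ℕ) = m := by omega
  rw [coeff_subst_eq_sum (constantCoeff_genPoly t), unfoldingSeries, hm',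
    sum_multiIndices t m fun r => ((r + 2 * ((b : ℕ) + 1) - 3).factorial : ℂ)
      / ((2 * ((b : ℕ) + 1) - 2).factorial : ℂ)]
  refine sum_congr rfl fun r _ => ?_
  rw [unfoldingKernel, coeff_mk]
  split_ifs with hr
  · have : m ≠ 0 := by omega
    simp [hr, coeff_one, this]
  · rw [show r + 2 * ((b : ℕ) + 1) - 3 = r + 2 * b - 1 by omega,
      show 2 * ((b : ℕ) + 1) - 2 = 2 * b by omega]

theorem coeff_subst_congr {A B : PowerSeries ℂ} (hA : constantCoeff A = 0)
    (hB : constantCoeff B = 0) {m : ℕ} (h : ∀ i ≤ m, coeff i A = coeff i B) (Q : PowerSeries ℂ) :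
    coeff m (Q.subst A : PowerSeries ℂ) = coeff m (Q.subst B : PowerSeries ℂ) := by
  rw [coeff_subst_eq_sum hA, coeff_subst_eq_sum hB]
  refine sum_congr rfl fun r _ => ?_
  have hd : X ^ (m + 1) ∣ A - B := X_pow_dvd_iff.2 fun i hi => by
    rw [map_sub, h i (by omega), sub_self]
  have := X_pow_dvd_iff.1 (hd.trans (sub_dvd_pow_sub_pow A B r)) m (Nat.lt_succ_self m)
  rw [map_sub, sub_eq_zero] at this
  rw [this]

/-- Up to degree N-1 the generating polynomial of ψ agrees with A. Applying X d/dX to the kernel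
evaluated at A gives X A' (1-A)^(-(2b+1)), whose coefficient is m v_b by Lagrange inversion. As m +
b = N-1, the same c = 2(N-1) serves every `b`. -/
theorem unfoldingSeries_psi {n : ℕ} (v : Fin (n + 2) → ℂ) (b : Fin (n + 1)) :
    unfoldingSeries n (psi n v) b = v b.castSucc := by
  obtain ⟨m, hm⟩ : ∃ m, m + (b : ℕ) = n + 1 := ⟨n + 1 - b, by omega⟩
  have hA := constantCoeff_inverseSeries (c := 2 * ((n : ℂ) + 1)) (g := genPoly v)
  rw [unfoldingSeries_eq_coeff _ b hm,
    coeff_subst_congr (constantCoeff_genPoly _) hA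
      (fun i hi => coeff_inverseSeries_eq_psi v (by omega)), ← coeff_genPoly v b,
    show n + 1 - (b : ℕ) = m by omega]
  have hm0 : (m : ℂ) ≠ 0 := by
    have : m ≠ 0 := by omega
    exact_mod_cast this
  apply mul_left_cancel₀ hm0
  rw [coeff_eq_coeff_inverseSeries (c := 2 * ((n : ℂ) + 1)) (constantCoeff_genPoly v)
    (m := m) (b := b), ← coeff_X_mul_derivative, derivative_subst (hasSubst hA),
    derivative_unfoldingKernel]
  · congr 1
    ring
  · have : (m : ℂ) + (b : ℕ) = n + 1 := by exact_mod_cast hm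
    linear_combination -2 * this

theorem X_pow_succ_dvd_pow_sub_pow {A B : PowerSeries ℂ} (hA : X ∣ A) (hB : X ∣ B) {m : ℕ}
    (h : X ^ m ∣ A - B) {r : ℕ} (hr : r ≠ 1) : X ^ (m + 1) ∣ A ^ r - B ^ r := by
  rcases r with _ | _ | r
  · simp
  · exact absurd rfl hr
  · rw [show A ^ (r + 1 + 1) - B ^ (r + 1 + 1)
      = (A ^ (r + 1) - B ^ (r + 1)) * A + (A - B) * B ^ (r + 1) by ring, pow_succ]
    refine dvd_add (mul_dvd_mul (h.trans (sub_dvd_pow_sub_pow A B _)) hA) (mul_dvd_mul h ?_)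
    exact dvd_pow hB (Nat.succ_ne_zero r)

/-- The system is triangular: the kernel has linear coefficient (2b)!/(2b)! = 1, and all other
powers of the generating polynomial involve only its lower coefficients in the degree considered. -/
theorem eq_of_unfoldingSeries_eq {n : ℕ} {t t' : Fin (n + 2) → ℂ}
    (h : ∀ b, unfoldingSeries n t b = unfoldingSeries n t' b) (k : Fin (n + 1)) :
    t k.castSucc = t' k.castSucc := by
  have key : ∀ m < n + 2, coeff m (genPoly t) = coeff m (genPoly t') := by
    intro m
    induction m using Nat.strong_induction_on with
    | _ m ih =>
      intro hm
      rcases Nat.eq_zero_or_pos m with rfl | hpos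
      · simp
      have hb : m + ((⟨n + 1 - m, by omega⟩ : Fin (n + 1)) : ℕ) = n + 1 := by simp; omega
      have h1 := h ⟨n + 1 - m, by omega⟩
      rw [unfoldingSeries_eq_coeff _ _ hb, unfoldingSeries_eq_coeff _ _ hb,
        coeff_subst_eq_sum (constantCoeff_genPoly t), coeff_subst_eq_sum (constantCoeff_genPoly t'),
        ← sub_eq_zero, ← sum_sub_distrib, sum_eq_single_of_mem 1 (by simp; omega)] at h1
      · rw [← mul_sub, mul_eq_zero, pow_one, pow_one, sub_eq_zero] at h1
        refine h1.resolve_left ?_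
        rw [unfoldingKernel, coeff_mk, if_neg one_ne_zero, Nat.add_sub_cancel_left]
        have : ((2 * (n + 1 - m)).factorial : ℂ) ≠ 0 := by exact_mod_cast Nat.factorial_ne_zero _
        simpa using this
      · intro r _ hr
        have hd : X ^ m ∣ genPoly t - genPoly t' := X_pow_dvd_iff.2 fun i hi => by
          rw [map_sub, ih i hi (by omega), sub_self]
        have := X_pow_dvd_iff.1 (X_pow_succ_dvd_pow_sub_pow (X_dvd_iff.2 (constantCoeff_genPoly t))
          (X_dvd_iff.2 (constantCoeff_genPoly t')) hd hr) m (Nat.lt_succ_self m)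
        rw [← mul_sub, ← map_sub, this, mul_zero]
  rw [← coeff_genPoly t k, ← coeff_genPoly t' k]
  exact key _ (by omega)

@[simp] theorem psi_last {n : ℕ} (v : Fin (n + 2) → ℂ) :
    psi n v (Fin.last (n + 1)) = v (Fin.last (n + 1)) := by
  rw [psi, Fin.lastCases_last]

theorem eq_psi_iff {n : ℕ} (v t : Fin (n + 2) → ℂ) :
    (∀ k, t k = psi n v k) ↔ ((∀ b : Fin (n + 1), v b.castSucc = unfoldingSeries n t b) ∧
      v (Fin.last (n + 1)) = t (Fin.last (n + 1))) := by
  constructor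
  · intro h
    obtain rfl : t = psi n v := funext h
    exact ⟨fun b => (unfoldingSeries_psi v b).symm, (psi_last v).symm⟩
  · rintro ⟨h1, h2⟩ k
    refine Fin.lastCases ?_ (fun k => ?_) k
    · rw [psi_last, h2]
    · exact eq_of_unfoldingSeries_eq (fun b => by rw [unfoldingSeries_psi, h1]) k

end DSing

namespace DSing
open Finset

/-! ### The residue functional and the pairing. -/

@[simp] theorem dirMonomial_castSucc (n : ℕ) (k : Fin (n + 1)) :
    dirMonomial n k.castSucc = MvPolynomial.X 0 ^ (k : ℕ) := by
  rw [dirMonomial, Fin.lastCases_castSucc]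

@[simp] theorem dirMonomial_last (n : ℕ) : dirMonomial n (Fin.last (n + 1)) = MvPolynomial.X 1 := by
  rw [dirMonomial, Fin.lastCases_last]

theorem pderiv_zero_unfolding (n : ℕ) (u : Fin (n + 2) → ℂ) :
    MvPolynomial.pderiv 0 (unfolding n u) = MvPolynomial.X 0 ^ n + MvPolynomial.X 1 ^ 2
      + ∑ k : Fin (n + 1), MvPolynomial.C (u k.castSucc * ((k : ℕ) : ℂ))
        * MvPolynomial.X 0 ^ ((k : ℕ) - 1) := by
  have hn : (n : ℂ) + 1 ≠ 0 := by exact_mod_cast n.succ_ne_zero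
  rw [unfolding, Fin.sum_univ_castSucc]
  simp only [dirMonomial_castSucc, dirMonomial_last, map_add, map_sum, Derivation.leibniz,
    Derivation.leibniz_pow, MvPolynomial.pderiv_C, MvPolynomial.pderiv_X_self, smul_eq_mul]
  rw [MvPolynomial.pderiv_X_of_ne (by decide : (1 : Fin 2) ≠ 0)]
  have h1 : (MvPolynomial.C (1 / ((n : ℂ) + 1)) * ((n + 1 : ℕ) : MvPolynomial (Fin 2) ℂ)) = 1 := by
    rw [← map_natCast (MvPolynomial.C (R := ℂ) (σ := Fin 2)), ← map_mul]
    push_cast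
    rw [one_div_mul_cancel hn, map_one]
  simp only [nsmul_eq_mul, mul_zero, mul_one, add_zero, zero_add, Nat.add_sub_cancel, map_mul,
    map_natCast]
  congr 1
  · linear_combination MvPolynomial.X 0 ^ n * h1
  · refine sum_congr rfl fun k _ => ?_
    ring

theorem pderiv_one_unfolding (n : ℕ) (u : Fin (n + 2) → ℂ) :
    MvPolynomial.pderiv 1 (unfolding n u) = 2 * MvPolynomial.X 0 * MvPolynomial.X 1
      + MvPolynomial.C (u (Fin.last (n + 1))) := by
  rw [unfolding, Fin.sum_univ_castSucc]
  simp only [dirMonomial_castSucc, dirMonomial_last, map_add, map_sum, Derivation.leibniz,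
    Derivation.leibniz_pow, MvPolynomial.pderiv_C, MvPolynomial.pderiv_X_self, smul_eq_mul]
  rw [MvPolynomial.pderiv_X_of_ne (by decide : (0 : Fin 2) ≠ 1)]
  simp
  ring

/-- The expansion of `x ^ (-n) ∂Λ/∂x` in `s = 1 / x` on the curve `∂Λ/∂y = 0`, near `x = ∞`. -/
noncomputable def curveSeries (n : ℕ) (u : Fin (n + 2) → ℂ) : PowerSeries ℂ :=
  1 + ∑ k : Fin (n + 1), PowerSeries.C (u k.castSucc * ((k : ℕ) : ℂ))
      * PowerSeries.X ^ (n + 1 - (k : ℕ))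
    + PowerSeries.C ((-u (Fin.last (n + 1)) / 2) ^ 2) * PowerSeries.X ^ (n + 2)

/-- The expansion of `y ^ (-2) ∂Λ/∂x` in `r = 1 / y` on the curve `∂Λ/∂y = 0`, near `y = ∞`. -/
noncomputable def curveSeries' (n : ℕ) (u : Fin (n + 2) → ℂ) : PowerSeries ℂ :=
  1 + PowerSeries.X ^ 2 * ((PowerSeries.C (-u (Fin.last (n + 1)) / 2) * PowerSeries.X) ^ n
    + ∑ k : Fin (n + 1), PowerSeries.C (u k.castSucc * ((k : ℕ) : ℂ))
      * (PowerSeries.C (-u (Fin.last (n + 1)) / 2) * PowerSeries.X) ^ ((k : ℕ) - 1))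

theorem constantCoeff_curveSeries (n : ℕ) (u : Fin (n + 2) → ℂ) :
    PowerSeries.constantCoeff (curveSeries n u) = 1 := by
  have : ∀ k : Fin (n + 1), n + 1 - (k : ℕ) ≠ 0 := fun k => by omega
  simp [curveSeries, this]

theorem constantCoeff_curveSeries' (n : ℕ) (u : Fin (n + 2) → ℂ) :
    PowerSeries.constantCoeff (curveSeries' n u) = 1 := by
  simp [curveSeries']

/-- Restriction of polynomials to the curve `∂Λ/∂y = 0`, near `x = ∞`. -/
noncomputable def expandX (n : ℕ) (u : Fin (n + 2) → ℂ) :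
    MvPolynomial (Fin 2) ℂ →+* LaurentSeries ℂ :=
  MvPolynomial.eval₂Hom HahnSeries.C
    ![HahnSeries.single (-1) 1, HahnSeries.single 1 (-u (Fin.last (n + 1)) / 2)]

/-- Restriction of polynomials to the curve `∂Λ/∂y = 0`, near `y = ∞`. -/
noncomputable def expandY (n : ℕ) (u : Fin (n + 2) → ℂ) :
    MvPolynomial (Fin 2) ℂ →+* LaurentSeries ℂ :=
  MvPolynomial.eval₂Hom HahnSeries.C
    ![HahnSeries.single 1 (-u (Fin.last (n + 1)) / 2), HahnSeries.single (-1) 1]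

section
variable (n : ℕ) (u : Fin (n + 2) → ℂ)

theorem expandX_X0 : expandX n u (MvPolynomial.X 0) = HahnSeries.single (-1) 1 := by
  simp [expandX]
theorem expandX_X1 : expandX n u (MvPolynomial.X 1)
    = HahnSeries.single 1 (-u (Fin.last (n + 1)) / 2) := by
  simp [expandX]
theorem expandY_X0 : expandY n u (MvPolynomial.X 0)
    = HahnSeries.single 1 (-u (Fin.last (n + 1)) / 2) := by
  simp [expandY]
theorem expandY_X1 : expandY n u (MvPolynomial.X 1) = HahnSeries.single (-1) 1 := by
  simp [expandY]

theorem expandX_C (r : ℂ) : expandX n u (MvPolynomial.C r) = HahnSeries.single 0 r :=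
  MvPolynomial.eval₂Hom_C _ _ _
theorem expandY_C (r : ℂ) : expandY n u (MvPolynomial.C r) = HahnSeries.single 0 r :=
  MvPolynomial.eval₂Hom_C _ _ _

theorem expandX_pderiv_one : expandX n u (MvPolynomial.pderiv 1 (unfolding n u)) = 0 := by
  rw [pderiv_one_unfolding, show (2 : MvPolynomial (Fin 2) ℂ) = MvPolynomial.C 2 from
    (map_ofNat MvPolynomial.C 2).symm]
  simp only [map_add, map_mul, expandX_X0, expandX_X1, expandX_C, HahnSeries.single_mul_single]
  rw [show (0 : ℤ) + -1 + 1 = 0 by norm_num, ← HahnSeries.single_add,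
    show 2 * 1 * (-u (Fin.last (n + 1)) / 2) + u (Fin.last (n + 1)) = 0 by ring, map_zero]

theorem expandY_pderiv_one : expandY n u (MvPolynomial.pderiv 1 (unfolding n u)) = 0 := by
  rw [pderiv_one_unfolding, show (2 : MvPolynomial (Fin 2) ℂ) = MvPolynomial.C 2 from
    (map_ofNat MvPolynomial.C 2).symm]
  simp only [map_add, map_mul, expandY_X0, expandY_X1, expandY_C, HahnSeries.single_mul_single]
  rw [show (0 : ℤ) + 1 + -1 = 0 by norm_num, ← HahnSeries.single_add,
    show 2 * (-u (Fin.last (n + 1)) / 2) * 1 + u (Fin.last (n + 1)) = 0 by ring, map_zero]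

theorem single_mul_coe_C_mul_X_pow (a : ℤ) (r : ℂ) (j : ℕ) :
    HahnSeries.single a (1 : ℂ)
      * ((PowerSeries.C r * PowerSeries.X ^ j : PowerSeries ℂ) : LaurentSeries ℂ)
      = HahnSeries.single (a + j) r := by
  rw [PowerSeries.coe_mul, PowerSeries.coe_C, PowerSeries.coe_pow, HahnSeries.ofPowerSeries_X,
    HahnSeries.single_pow,
    HahnSeries.C_apply, HahnSeries.single_mul_single, HahnSeries.single_mul_single]
  simp

theorem expandX_pderiv_zero : expandX n u (MvPolynomial.pderiv 0 (unfolding n u))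
    = HahnSeries.single (-n : ℤ) (1 : ℂ) * (curveSeries n u : LaurentSeries ℂ) := by
  rw [pderiv_zero_unfolding, curveSeries, PowerSeries.coe_add, PowerSeries.coe_add, mul_add, mul_add,
    single_mul_coe_C_mul_X_pow, PowerSeries.coe_one, mul_one, map_sum, mul_sum]
  simp_rw [single_mul_coe_C_mul_X_pow]
  simp only [map_add, map_mul, map_pow, expandX_X0, expandX_X1, expandX_C, map_sum,
    HahnSeries.single_pow, HahnSeries.single_mul_single]
  rw [add_right_comm]
  congr 1
  · congr 1
    · simp
    · refine sum_congr rfl fun k _ => ?_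
      -- At `k = 0` the exponent `k - 1` truncates, but the coefficient is 0.
      rcases Nat.eq_zero_or_pos (k : ℕ) with hk | hk
      · simp [hk]
      · congr 1
        · simp
          congr 1
          omega
        · simp
  · congr 1
    simp

theorem expandY_pderiv_zero : expandY n u (MvPolynomial.pderiv 0 (unfolding n u))
    = HahnSeries.single (-2 : ℤ) (1 : ℂ) * (curveSeries' n u : LaurentSeries ℂ) := by
  have h : (HahnSeries.single (1 : ℤ) (-u (Fin.last (n + 1)) / 2) : LaurentSeries ℂ)
      = ((PowerSeries.C (-u (Fin.last (n + 1)) / 2) * PowerSeries.X : PowerSeries ℂ)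
        : LaurentSeries ℂ) := by
    have := single_mul_coe_C_mul_X_pow 0 (-u (Fin.last (n + 1)) / 2) 1
    simpa using this.symm
  rw [pderiv_zero_unfolding, curveSeries']
  simp only [map_add, map_mul, map_pow, expandY_X0, expandY_X1, expandY_C, map_sum, map_one, h]
  rw [mul_add, ← mul_assoc, HahnSeries.ofPowerSeries_X,
    HahnSeries.single_pow,
    HahnSeries.single_pow, HahnSeries.single_mul_single]
  simp only [HahnSeries.ofPowerSeries_C, HahnSeries.C_apply]
  norm_num
  ring

/-- The residue functional on `ℂ[x, y]`, normalized by its value `1` at `x ^ (N - 2)`. -/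
noncomputable def residue : MvPolynomial (Fin 2) ℂ →ₗ[ℂ] ℂ where
  toFun q := (expandX n u q * (HahnSeries.single (n : ℤ) (1 : ℂ)
      * ((curveSeries n u)⁻¹ : PowerSeries ℂ))).coeff 0
    - (expandY n u q * (HahnSeries.single (2 : ℤ) (1 : ℂ)
      * ((curveSeries' n u)⁻¹ : PowerSeries ℂ))).coeff 0
  map_add' p q := by
    simp only [map_add, add_mul, HahnSeries.coeff_add]
    ring
  map_smul' r q := by
    rw [MvPolynomial.smul_eq_C_mul, map_mul, map_mul, expandX_C, expandY_C, mul_assoc, mul_assoc,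
      HahnSeries.coeff_single_zero_mul, HahnSeries.coeff_single_zero_mul, RingHom.id_apply,
      smul_eq_mul, mul_sub]

theorem residue_apply (q : MvPolynomial (Fin 2) ℂ) : residue n u q =
    (expandX n u q * (HahnSeries.single (n : ℤ) (1 : ℂ)
      * ((curveSeries n u)⁻¹ : PowerSeries ℂ))).coeff 0
    - (expandY n u q * (HahnSeries.single (2 : ℤ) (1 : ℂ)
      * ((curveSeries' n u)⁻¹ : PowerSeries ℂ))).coeff 0 := rfl

/-- At either end x^a y^b becomes a single power of the local parameter, of exponent b-a or a-b; it
is constant only for a = b, with value (-u_N/2)^a at both ends. This also covers u_N = 0, where the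
curve degenerates. -/
theorem coeff_zero_expandX (q : MvPolynomial (Fin 2) ℂ) :
    (expandX n u q).coeff 0 = (expandY n u q).coeff 0 := by
  induction q using MvPolynomial.induction_on' with
  | add p q hp hq => simp only [map_add, HahnSeries.coeff_add, hp, hq]
  | monomial d r =>
    rw [MvPolynomial.monomial_eq, Finsupp.prod_fintype _ _ (by simp), Fin.prod_univ_two]
    simp only [map_mul, map_pow, expandX_X0, expandX_X1, expandX_C, expandY_X0, expandY_X1,
      expandY_C, HahnSeries.single_pow, HahnSeries.single_mul_single]
    by_cases h : d 0 = d 1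
    · simp [h]
    · rw [HahnSeries.coeff_single_of_ne, HahnSeries.coeff_single_of_ne]
      · simp; omega
      · simp; omega

/-- Multiples of ∂_yΛ vanish on the curve; a multiple a ∂_xΛ leaves the constant terms of `a` at the
two ends, which cancel. -/
theorem residue_eq_zero {q : MvPolynomial (Fin 2) ℂ} (hq : q ∈ jacobianIdeal n u) :
    residue n u q = 0 := by
  rw [jacobianIdeal, Ideal.mem_span_pair] at hq
  obtain ⟨a, b, rfl⟩ := hq
  have h1 : (HahnSeries.single (-n : ℤ) (1 : ℂ) * (curveSeries n u : LaurentSeries ℂ))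
      * (HahnSeries.single (n : ℤ) (1 : ℂ)
        * (((curveSeries n u)⁻¹ : PowerSeries ℂ) : LaurentSeries ℂ)) = 1 := by
    rw [mul_mul_mul_comm, HahnSeries.single_mul_single, ← PowerSeries.coe_mul,
      PowerSeries.mul_inv_cancel _ (by rw [constantCoeff_curveSeries]; exact one_ne_zero)]
    simp
  have h2 : (HahnSeries.single (-2 : ℤ) (1 : ℂ) * (curveSeries' n u : LaurentSeries ℂ))
      * (HahnSeries.single (2 : ℤ) (1 : ℂ)
        * (((curveSeries' n u)⁻¹ : PowerSeries ℂ) : LaurentSeries ℂ)) = 1 := by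
    rw [mul_mul_mul_comm, HahnSeries.single_mul_single, ← PowerSeries.coe_mul,
      PowerSeries.mul_inv_cancel _ (by rw [constantCoeff_curveSeries']; exact one_ne_zero)]
    simp
  rw [residue_apply]
  simp only [map_add, map_mul, expandX_pderiv_one, expandY_pderiv_one, expandX_pderiv_zero,
    expandY_pderiv_zero, mul_zero, add_zero, mul_assoc (expandX n u a), mul_assoc (expandY n u a),
    h1, h2, mul_one]
  rw [coeff_zero_expandX, sub_self]

theorem coeff_zero_single_mul (a : ℤ) (r : ℂ) (P : PowerSeries ℂ) :
    (HahnSeries.single a r * (P : LaurentSeries ℂ)).coeff 0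
      = if 0 < a then 0 else r * PowerSeries.coeff a.natAbs P := by
  rw [HahnSeries.coeff_single_mul, PowerSeries.coeff_coe]
  simp

theorem residue_X0_pow (m : ℕ) : residue n u (MvPolynomial.X 0 ^ m)
    = if m < n then 0 else PowerSeries.coeff (m - n) (curveSeries n u)⁻¹ := by
  rw [residue_apply]
  simp only [map_pow, expandX_X0, expandY_X0, HahnSeries.single_pow]
  rw [← mul_assoc, ← mul_assoc, HahnSeries.single_mul_single, HahnSeries.single_mul_single,
    coeff_zero_single_mul, coeff_zero_single_mul,
    if_pos (show (0 : ℤ) < m • (1 : ℤ) + 2 by simp; omega), sub_zero]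
  by_cases h : m < n
  · rw [if_pos h, if_pos (by simp; omega)]
  · rw [if_neg h, if_neg (by simp; omega)]
    simp
    congr 2
    omega

theorem residue_X0_pow_mul_X1 {m : ℕ} (hm : m ≤ n) :
    residue n u (MvPolynomial.X 0 ^ m * MvPolynomial.X 1) = 0 := by
  rw [residue_apply]
  simp only [map_mul, map_pow, expandX_X0, expandY_X0, expandX_X1, expandY_X1,
    HahnSeries.single_pow, HahnSeries.single_mul_single]
  rw [← mul_assoc, ← mul_assoc, HahnSeries.single_mul_single, HahnSeries.single_mul_single,
    coeff_zero_single_mul, coeff_zero_single_mul, if_pos (by simp; omega),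
    if_pos (by simp; omega), sub_zero]

theorem residue_X1_mul_X1 :
    residue n u (MvPolynomial.X 1 * MvPolynomial.X 1) = -1 := by
  rw [residue_apply]
  simp only [map_mul, expandX_X1, expandY_X1, HahnSeries.single_mul_single]
  rw [← mul_assoc, ← mul_assoc, HahnSeries.single_mul_single, HahnSeries.single_mul_single,
    coeff_zero_single_mul, coeff_zero_single_mul, if_pos (by omega), if_neg (by simp)]
  simp [constantCoeff_curveSeries']

theorem residue_dirMonomial (s : Fin (n + 2)) :
    residue n u (dirMonomial n s) = if s = (Fin.last n).castSucc then 1 else 0 := by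
  refine Fin.lastCases ?_ (fun s => ?_) s
  · have := residue_X0_pow_mul_X1 n u (Nat.zero_le n)
    rw [pow_zero, one_mul] at this
    rw [dirMonomial_last, this, if_neg]
    exact (Fin.castSucc_lt_last (Fin.last n)).ne'
  · rw [dirMonomial_castSucc, residue_X0_pow]
    by_cases h : s = Fin.last n
    · subst h
      simp [constantCoeff_curveSeries]
    · have h1 : (s : ℕ) < n := Fin.val_lt_last h
      rw [if_pos h1, if_neg (by simpa using h)]

/-- The Gram matrix of the pairing in the basis `∂/∂u_1, …, ∂/∂u_N`. -/
noncomputable def pairingMatrix : Matrix (Fin (n + 2)) (Fin (n + 2)) ℂ :=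
  Matrix.of fun a b => residue n u (dirMonomial n a * dirMonomial n b)

/-- Applying `residue` to the multiplication rule isolates the coefficient of x^(N-2), so linear
independence of the classes is not needed. -/
theorem IsStructureConstants.eq_pairingMatrix {c : Fin (n + 2) → Fin (n + 2) → Fin (n + 2) → ℂ}
    (hc : IsStructureConstants n u c) (a b : Fin (n + 2)) :
    c a b (Fin.last n).castSucc = pairingMatrix n u a b := by
  have h := hc a b
  have h1 : ∑ s, c a b s • dirClass n u s
      = Ideal.Quotient.mk (jacobianIdeal n u) (∑ s, c a b s • dirMonomial n s) := by
    rw [map_sum]; rfl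
  rw [h1, dirClass, dirClass, ← map_mul, Ideal.Quotient.eq] at h
  have h2 := residue_eq_zero n u h
  rw [map_sub, map_sum, sub_eq_zero] at h2
  rw [pairingMatrix, Matrix.of_apply, h2]
  simp [residue_dirMonomial]

end

/-! ### Existence of structure constants: the classes span the local algebra. -/

section
variable (n : ℕ) (u : Fin (n + 2) → ℂ)

theorem mk_C (r : ℂ) : Ideal.Quotient.mk (jacobianIdeal n u) (MvPolynomial.C r)
    = r • (1 : LocalAlgebra n u) := by
  rw [← MvPolynomial.algebraMap_eq, Algebra.algebraMap_eq_smul_one]; rfl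

theorem mk_X0_mul_mk_X1 : Ideal.Quotient.mk (jacobianIdeal n u) (MvPolynomial.X 0)
      * Ideal.Quotient.mk (jacobianIdeal n u) (MvPolynomial.X 1)
    = (-u (Fin.last (n + 1)) / 2) • (1 : LocalAlgebra n u) := by
  have h : MvPolynomial.pderiv 1 (unfolding n u) ∈ jacobianIdeal n u :=
    Ideal.subset_span (by simp)
  rw [← mk_C, ← map_mul, Ideal.Quotient.eq]
  have h2 := Ideal.mul_mem_left _ (MvPolynomial.C (1 / 2)) h
  rw [pderiv_one_unfolding] at h2
  convert h2 using 1
  have h3 : (MvPolynomial.C (1 / 2 : ℂ) : MvPolynomial (Fin 2) ℂ) * 2 = 1 := by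
    rw [show (2 : MvPolynomial (Fin 2) ℂ) = MvPolynomial.C 2 from
    (map_ofNat MvPolynomial.C 2).symm, ← map_mul]
    norm_num
  have h4 : (MvPolynomial.C (-u (Fin.last (n + 1)) / 2) : MvPolynomial (Fin 2) ℂ)
      = - (MvPolynomial.C (1 / 2) * MvPolynomial.C (u (Fin.last (n + 1)))) := by
    rw [← map_mul, ← map_neg]
    congr 1
    ring
  rw [h4]
  linear_combination -MvPolynomial.X 0 * MvPolynomial.X 1 * h3

theorem mk_X1_sq : Ideal.Quotient.mk (jacobianIdeal n u) (MvPolynomial.X 1) ^ 2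
    = -(Ideal.Quotient.mk (jacobianIdeal n u) (MvPolynomial.X 0) ^ n
      + ∑ k : Fin (n + 1), (u k.castSucc * ((k : ℕ) : ℂ)) •
        Ideal.Quotient.mk (jacobianIdeal n u) (MvPolynomial.X 0) ^ ((k : ℕ) - 1)) := by
  have h : MvPolynomial.pderiv 0 (unfolding n u) ∈ jacobianIdeal n u :=
    Ideal.subset_span (by simp)
  rw [pderiv_zero_unfolding] at h
  have h2 := Ideal.Quotient.eq_zero_iff_mem.2 h
  simp only [map_add, map_sum, map_mul _ (MvPolynomial.C _), map_pow, mk_C,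
    smul_mul_assoc, one_mul] at h2
  linear_combination h2

theorem span_dirClass : Submodule.span ℂ (Set.range (dirClass n u)) = ⊤ := by
  set W := Submodule.span ℂ (Set.range (dirClass n u)) with hW
  set x := Ideal.Quotient.mk (jacobianIdeal n u) (MvPolynomial.X 0) with hx
  set y := Ideal.Quotient.mk (jacobianIdeal n u) (MvPolynomial.X 1) with hy
  have hxk : ∀ k ≤ n, x ^ k ∈ W := fun k hk =>
    Submodule.subset_span ⟨(⟨k, by omega⟩ : Fin (n + 1)).castSucc, by
      rw [dirClass, dirMonomial_castSucc, map_pow]⟩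
  have hyW : y ∈ W := Submodule.subset_span ⟨Fin.last (n + 1), by simp [dirClass, hy]⟩
  have h1W : (1 : LocalAlgebra n u) ∈ W := by simpa using hxk 0 (Nat.zero_le n)
  have hxy := mk_X0_mul_mk_X1 n u
  have hyy := mk_X1_sq n u
  rw [← hx, ← hy] at hxy
  rw [← hx, ← hy] at hyy
  have hsum : ∑ k : Fin (n + 1), (u k.castSucc * ((k : ℕ) : ℂ)) • x ^ (k : ℕ) ∈ W :=
    Submodule.sum_mem _ fun k _ => Submodule.smul_mem _ _ (hxk k (by omega))
  -- Multiply the relation for y² by x and replace xy by the scalar -u_N/2.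
  have hxn : x ^ (n + 1) ∈ W := by
    have h : x ^ (n + 1) = -((-u (Fin.last (n + 1)) / 2) • y)
        - ∑ k : Fin (n + 1), (u k.castSucc * ((k : ℕ) : ℂ)) • x ^ (k : ℕ) := by
      have h3 : x * ∑ k : Fin (n + 1), (u k.castSucc * ((k : ℕ) : ℂ)) • x ^ ((k : ℕ) - 1)
          = ∑ k : Fin (n + 1), (u k.castSucc * ((k : ℕ) : ℂ)) • x ^ (k : ℕ) := by
        rw [mul_sum]
        refine sum_congr rfl fun k _ => ?_
        rw [mul_smul_comm]
        rcases Nat.eq_zero_or_pos (k : ℕ) with hk | hk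
        · simp [hk]
        · rw [← pow_succ', Nat.sub_add_cancel hk]
      have h4 : x * y * y = (-u (Fin.last (n + 1)) / 2) • y := by
        rw [hxy, smul_mul_assoc, one_mul]
      rw [← h3, ← h4]
      linear_combination x * hyy
    rw [h]
    exact Submodule.sub_mem _ (Submodule.neg_mem _ (Submodule.smul_mem _ _ hyW)) hsum
  have hmulx : ∀ q ∈ W, q * x ∈ W := by
    intro q hq
    induction hq using Submodule.span_induction with
    | zero => simp
    | add p q _ _ hp hq => rw [add_mul]; exact Submodule.add_mem _ hp hq
    | smul r q _ hq => rw [smul_mul_assoc]; exact Submodule.smul_mem _ _ hq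
    | mem q hq =>
      obtain ⟨k, rfl⟩ := hq
      refine Fin.lastCases ?_ (fun k => ?_) k
      · rw [dirClass, dirMonomial_last, mul_comm, hxy]
        exact Submodule.smul_mem _ _ h1W
      · rw [dirClass, dirMonomial_castSucc, map_pow, ← hx, ← pow_succ]
        rcases Nat.lt_or_ge (k : ℕ) n with hk | hk
        · exact hxk _ hk
        · rw [show (k : ℕ) = n by omega]
          exact hxn
  have hmuly : ∀ q ∈ W, q * y ∈ W := by
    intro q hq
    induction hq using Submodule.span_induction with
    | zero => simp
    | add p q _ _ hp hq => rw [add_mul]; exact Submodule.add_mem _ hp hq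
    | smul r q _ hq => rw [smul_mul_assoc]; exact Submodule.smul_mem _ _ hq
    | mem q hq =>
      obtain ⟨k, rfl⟩ := hq
      refine Fin.lastCases ?_ (fun k => ?_) k
      · rw [dirClass, dirMonomial_last, ← hy, ← pow_two, hyy]
        refine Submodule.neg_mem _ (Submodule.add_mem _ (hxk n le_rfl)
          (Submodule.sum_mem _ fun k _ => Submodule.smul_mem _ _ (hxk _ (by omega))))
      · rw [dirClass, dirMonomial_castSucc, map_pow, ← hx]
        rcases Nat.eq_zero_or_pos (k : ℕ) with hk | hk
        · rw [hk, pow_zero, one_mul]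
          exact hyW
        · rw [← Nat.sub_add_cancel hk, pow_succ, mul_assoc, hxy, mul_smul_comm, mul_one]
          exact Submodule.smul_mem _ _ (hxk _ (by omega))
  rw [eq_top_iff]
  rintro q -
  obtain ⟨p, rfl⟩ := Ideal.Quotient.mk_surjective q
  induction p using MvPolynomial.induction_on with
  | C r => rw [mk_C]; exact Submodule.smul_mem _ _ h1W
  | add p q hp hq => rw [map_add]; exact Submodule.add_mem _ hp hq
  | mul_X p i hp =>
    rw [map_mul]
    fin_cases i
    · exact hmulx _ hp
    · exact hmuly _ hp

theorem exists_isStructureConstants : ∃ c, IsStructureConstants n u c := by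
  have h : ∀ a b, ∃ f : Fin (n + 2) → ℂ, ∑ s, f s • dirClass n u s
      = dirClass n u a * dirClass n u b := fun a b =>
    Submodule.mem_span_range_iff_exists_fun ℂ |>.1 (by rw [span_dirClass]; trivial)
  choose c hc using h
  exact ⟨c, fun a b => (hc a b).symm⟩

end

theorem isPairing_iff {n : ℕ}
    {η : (Fin (n + 2) → ℂ) → Matrix (Fin (n + 2)) (Fin (n + 2)) ℂ} :
    IsPairing n η ↔ ∀ u, η u = pairingMatrix n u := by
  constructor
  · intro h u
    obtain ⟨c, hc, hη⟩ := h u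
    ext a b
    rw [hη, hc.eq_pairingMatrix]
  · intro h u
    obtain ⟨c, hc⟩ := exists_isStructureConstants n u
    exact ⟨c, hc, fun a b => by rw [h, hc.eq_pairingMatrix]⟩

end DSing

namespace DSing
open PowerSeries Finset

/-! ### The inverse pairing and the algebraic identity behind flatness. -/

theorem coeff_mul_eq_sum_range {f g : PowerSeries ℂ} {a n : ℕ} (h : a ≤ n) :
    coeff a (f * g)
      = ∑ i ∈ range (n + 1), coeff i f * (if i ≤ a then coeff (a - i) g else 0) := by
  rw [coeff_mul, Nat.sum_antidiagonal_eq_sum_range_succ_mk,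
    ← sum_subset (range_subset_range.2 (Nat.succ_le_succ h))]
  · refine sum_congr rfl fun i hi => ?_
    rw [if_pos (Nat.lt_succ_iff.1 (mem_range.1 hi))]
  · intro i _ hi
    rw [if_neg (fun h => hi (mem_range.2 (Nat.lt_succ_of_le h))), mul_zero]

/-- The Gram matrix of the inverse pairing in the basis `du_1, …, du_N`. -/
noncomputable def copairingMatrix (n : ℕ) (u : Fin (n + 2) → ℂ) :
    Matrix (Fin (n + 2)) (Fin (n + 2)) ℂ :=
  Matrix.of fun a b => Fin.lastCases (Fin.lastCases (-1) (fun _ => 0) b)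
    (fun a : Fin (n + 1) => Fin.lastCases 0 (fun b : Fin (n + 1) =>
      if (b : ℕ) ≤ n - a then coeff (n - a - b) (curveSeries n u) else 0) b) a

/-- The matrix `(∂T_γ/∂u_a)` of the explicit flat coordinates, where
`∂T_γ/∂u_a` is the coefficient of `s ^ (a - γ)` in
`(1 + (N - 1) ∑ u_k s ^ (N - k)) ^ ((1 - 2γ) / (2N - 2))`. -/
noncomputable def flatJacobian (n : ℕ) (u : Fin (n + 2) → ℂ) :
    Matrix (Fin (n + 2)) (Fin (n + 2)) ℂ :=
  Matrix.of fun γ a => Fin.lastCases (Fin.lastCases 1 (fun _ => 0) a)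
    (fun γ : Fin (n + 1) => Fin.lastCases 0 (fun a : Fin (n + 1) =>
      coeff a (X ^ (γ : ℕ) * rootPow (2 * (n + 1)) (genPoly fun j => u j / 2)
        (-(2 * (γ : ℕ) + 1)))) a) γ

section
variable (n : ℕ) (u : Fin (n + 2) → ℂ)

theorem pairingMatrix_castSucc (a b : Fin (n + 1)) :
    pairingMatrix n u a.castSucc b.castSucc
      = if n - a ≤ b then coeff (b - (n - a)) (curveSeries n u)⁻¹ else 0 := by
  rw [pairingMatrix, Matrix.of_apply, dirMonomial_castSucc, dirMonomial_castSucc, ← pow_add,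
    residue_X0_pow]
  by_cases h : (a : ℕ) + b < n
  · rw [if_pos h, if_neg (by omega)]
  · rw [if_neg h, if_pos (by omega)]
    congr 2
    omega

theorem pairingMatrix_castSucc_last (a : Fin (n + 1)) :
    pairingMatrix n u a.castSucc (Fin.last (n + 1)) = 0 := by
  rw [pairingMatrix, Matrix.of_apply, dirMonomial_castSucc, dirMonomial_last,
    residue_X0_pow_mul_X1 n u (by omega)]

theorem pairingMatrix_last_castSucc (b : Fin (n + 1)) :
    pairingMatrix n u (Fin.last (n + 1)) b.castSucc = 0 := by
  rw [pairingMatrix, Matrix.of_apply, dirMonomial_castSucc, dirMonomial_last, mul_comm,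
    residue_X0_pow_mul_X1 n u (by omega)]

theorem pairingMatrix_last_last :
    pairingMatrix n u (Fin.last (n + 1)) (Fin.last (n + 1)) = -1 := by
  rw [pairingMatrix, Matrix.of_apply, dirMonomial_last, residue_X1_mul_X1]

theorem pairingMatrix_transpose : (pairingMatrix n u).transpose = pairingMatrix n u := by
  ext a b
  rw [Matrix.transpose_apply, pairingMatrix, Matrix.of_apply, Matrix.of_apply, mul_comm]

theorem copairingMatrix_mul_pairingMatrix : copairingMatrix n u * pairingMatrix n u = 1 := by
  ext a d
  rw [Matrix.mul_apply, Fin.sum_univ_castSucc]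
  refine Fin.lastCases ?_ (fun a => ?_) a <;> refine Fin.lastCases ?_ (fun d => ?_) d
  · simp [copairingMatrix, pairingMatrix_last_last]
  · rw [Matrix.one_apply_ne (Fin.castSucc_lt_last d).ne']
    simp [copairingMatrix, pairingMatrix_last_castSucc]
  · rw [Matrix.one_apply_ne (Fin.castSucc_lt_last a).ne]
    simp [copairingMatrix, pairingMatrix_castSucc_last]
  · have h : coeff (d : ℕ) (X ^ (a : ℕ) * (curveSeries n u * (curveSeries n u)⁻¹))
        = if a = d then 1 else 0 := by
      rw [PowerSeries.mul_inv_cancel _ (by rw [constantCoeff_curveSeries]; exact one_ne_zero),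
        mul_one, coeff_X_pow]
      simp only [Fin.ext_iff, eq_comm]
    rw [Matrix.one_apply]
    simp only [Fin.castSucc_inj]
    -- Reversing the summation index turns the product of the two Hankel matrices into the Cauchy
    -- product of F and 1/F.
    rw [← h, ← mul_assoc, coeff_mul_eq_sum_range (n := n) (by omega), ← sum_range_reflect,
      ← Fin.sum_univ_eq_sum_range fun j => coeff (n + 1 - 1 - j) (X ^ (a : ℕ) * curveSeries n u)
        * (if n + 1 - 1 - j ≤ (d : ℕ) then coeff (d - (n + 1 - 1 - j)) (curveSeries n u)⁻¹ else 0)]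
    rw [pairingMatrix_last_castSucc, mul_zero, add_zero]
    refine sum_congr rfl fun j _ => ?_
    rw [pairingMatrix_castSucc, coeff_X_pow_mul', Nat.add_sub_cancel]
    congr 1
    simp only [copairingMatrix, Matrix.of_apply, Fin.lastCases_castSucc]
    by_cases h1 : (j : ℕ) ≤ n - a
    · rw [if_pos h1, if_pos (by omega)]
      congr 2
      omega
    · rw [if_neg h1, if_neg (by omega)]

theorem isUnit_det_pairingMatrix : IsUnit (pairingMatrix n u).det :=
  (Matrix.isUnit_iff_isUnit_det _).1
    (IsUnit.of_mul_eq_one_right _ (copairingMatrix_mul_pairingMatrix n u))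

/-- The first summand is 1 + cg - 2sg', in which v_k = u_k/2 gets the coefficient 2(N-1) - 2(N-k) =
2(k-1). -/
theorem curveSeries_eq : curveSeries n u
    = rootPow (2 * (n + 1)) (genPoly fun j => u j / 2) (2 * (n + 1))
        * jacFactor (2 * (n + 1)) (genPoly fun j => u j / 2)
      + C ((-u (Fin.last (n + 1)) / 2) ^ 2) * X ^ (n + 2) := by
  set g := genPoly fun j => u j / 2 with hgdef
  have hg : constantCoeff g = 0 := constantCoeff_genPoly _
  have h1 := rootPow_self (c := 2 * ((n : ℂ) + 1)) hg
  have h2 := rootPow_mul_neg (c := 2 * ((n : ℂ) + 1)) hg (2 * (n + 1))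
  rw [curveSeries]
  congr 1
  have h3 : rootPow (2 * (n + 1)) g (2 * (n + 1)) * jacFactor (2 * (n + 1)) g
      = 1 + C (2 * ((n : ℂ) + 1)) * g - C 2 * (X * derivative ℂ g) := by
    rw [jacFactor, rootLogDeriv]
    linear_combination h1 - C 2 * X * derivative ℂ g * h2
  rw [h3, add_sub_assoc]
  congr 1
  ext i
  rw [map_sub, coeff_C_mul, coeff_C_mul, coeff_X_mul_derivative, hgdef, genPoly, map_sum, map_sum,
    mul_sum, mul_sum, mul_sum, ← sum_sub_distrib]
  refine sum_congr rfl fun k _ => ?_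
  rw [coeff_C_mul, coeff_C_mul, coeff_X_pow]
  split_ifs with h
  · have : (i : ℂ) + (k : ℕ) = n + 1 := by
      have : i + (k : ℕ) = n + 1 := by omega
      exact_mod_cast this
    linear_combination u k.castSucc * this
  · simp

theorem curveSeries_zero : curveSeries n 0 = 1 := by
  simp [curveSeries]

/-- The matrix product is a double convolution, that is, one coefficient of s^n. The exponents of P
add up to 2(n-α-β) for zero-based indices, and the term with u_N² starts only at s^(n+2). -/
theorem flatJacobian_mul_copairing_mul_transpose :
    flatJacobian n u * copairingMatrix n u * (flatJacobian n u).transpose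
      = copairingMatrix n 0 := by
  set g := genPoly fun j => u j / 2 with hgdef
  have hg : constantCoeff g = 0 := constantCoeff_genPoly _
  ext α β
  rw [Matrix.mul_assoc, Matrix.mul_apply]
  simp_rw [Matrix.mul_apply]
  simp only [Fin.sum_univ_castSucc (n := n + 1), Matrix.transpose_apply]
  refine Fin.lastCases ?_ (fun α => ?_) α <;> refine Fin.lastCases ?_ (fun β => ?_) β
  · simp [copairingMatrix, flatJacobian]
  · simp [copairingMatrix, flatJacobian]
  · simp [copairingMatrix, flatJacobian]
  · simp only [copairingMatrix, flatJacobian, Matrix.of_apply, Fin.lastCases_castSucc,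
      Fin.lastCases_last, ← hgdef, zero_mul, mul_zero, add_zero, curveSeries_zero]
    set y := fun γ : ℕ => rootPow (2 * ((n : ℂ) + 1)) g (-(2 * (γ : ℂ) + 1)) with hy
    have h1 : ∀ a : Fin (n + 1), ∑ b : Fin (n + 1),
        (if (b : ℕ) ≤ n - a then coeff (n - a - b) (curveSeries n u) else 0)
          * coeff b (X ^ (β : ℕ) * y β) = coeff (n - a) (X ^ (β : ℕ) * y β * curveSeries n u) := by
      intro a
      rw [coeff_mul_eq_sum_range (n := n) (by omega), ← Fin.sum_univ_eq_sum_range fun b =>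
        coeff b (X ^ (β : ℕ) * y β) * (if b ≤ n - a then coeff (n - a - b) (curveSeries n u) else 0)]
      exact sum_congr rfl fun b _ => mul_comm _ _
    have h2 : ∑ a : Fin (n + 1), coeff a (X ^ (α : ℕ) * y α)
          * coeff (n - a) (X ^ (β : ℕ) * y β * curveSeries n u)
        = coeff n (X ^ (α : ℕ) * y α * (X ^ (β : ℕ) * y β * curveSeries n u)) := by
      rw [coeff_mul_eq_sum_range (n := n) le_rfl, ← Fin.sum_univ_eq_sum_range fun a =>
        coeff a (X ^ (α : ℕ) * y α)
          * (if a ≤ n then coeff (n - a) (X ^ (β : ℕ) * y β * curveSeries n u) else 0)]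
      refine sum_congr rfl fun a _ => ?_
      rw [if_pos (by omega)]
    have h3 : X ^ (α : ℕ) * y α * (X ^ (β : ℕ) * y β * curveSeries n u)
        = X ^ ((α : ℕ) + β) * (rootPow (2 * (n + 1)) g (2 * (n - α - β))
            * jacFactor (2 * (n + 1)) g)
          + X ^ (n + 2) * (X ^ ((α : ℕ) + β) * y α * y β
            * C ((-u (Fin.last (n + 1)) / 2) ^ 2)) := by
      have : rootPow (2 * ((n : ℂ) + 1)) g (2 * (n - α - β))
          = y α * y β * rootPow (2 * ((n : ℂ) + 1)) g (2 * (n + 1)) := by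
        rw [hy, ← rootPow_add hg, ← rootPow_add hg]
        congr 1
        ring
      rw [curveSeries_eq, ← hgdef, this, pow_add]
      ring
    rw [sum_congr rfl fun a _ => congrArg _ (h1 a), h2, h3, map_add, coeff_X_pow_mul',
      coeff_X_pow_mul', if_neg (show ¬ n + 2 ≤ n by omega), add_zero]
    by_cases h : (α : ℕ) + β ≤ n
    · have hc : (2 * ((n : ℂ) - α - β)) = 2 * ((n - (α + β) : ℕ) : ℂ) := by
        rw [Nat.cast_sub h]; push_cast; ring
      rw [if_pos h, if_pos (by omega), hc, coeff_rootPow_mul_jacFactor hg, coeff_one, Nat.sub_sub]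
    · rw [if_neg h, if_neg (by omega)]

theorem isUnit_det_flatJacobian : IsUnit (flatJacobian n u).det := by
  have h := congrArg Matrix.det (flatJacobian_mul_copairing_mul_transpose n u)
  rw [Matrix.det_mul, Matrix.det_mul, mul_assoc] at h
  have h0 := congrArg Matrix.det (copairingMatrix_mul_pairingMatrix n 0)
  rw [Matrix.det_mul, Matrix.det_one, ← h, mul_assoc] at h0
  exact IsUnit.of_mul_eq_one _ h0

theorem gram_flatJacobian :
    ((flatJacobian n u)⁻¹).transpose * pairingMatrix n u * (flatJacobian n u)⁻¹
      = pairingMatrix n 0 := by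
  have hJ := isUnit_det_flatJacobian n u
  set J := flatJacobian n u
  have h1 : copairingMatrix n 0 * ((J⁻¹).transpose * pairingMatrix n u * J⁻¹) = 1 := by
    have h2 : J.transpose * (J⁻¹).transpose = 1 := by
      rw [← Matrix.transpose_mul, Matrix.nonsing_inv_mul _ hJ, Matrix.transpose_one]
    rw [← flatJacobian_mul_copairing_mul_transpose n u]
    calc J * copairingMatrix n u * J.transpose * ((J⁻¹).transpose * pairingMatrix n u * J⁻¹)
        = J * copairingMatrix n u * (J.transpose * (J⁻¹).transpose) * pairingMatrix n u * J⁻¹ := by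
          simp only [Matrix.mul_assoc]
      _ = J * (copairingMatrix n u * pairingMatrix n u) * J⁻¹ := by
          rw [h2, Matrix.mul_one]; simp only [Matrix.mul_assoc]
      _ = 1 := by
          rw [copairingMatrix_mul_pairingMatrix, Matrix.mul_one, Matrix.mul_nonsing_inv _ hJ]
  have h3 := copairingMatrix_mul_pairingMatrix n 0
  have h4 := mul_eq_one_comm.1 h3
  calc _ = pairingMatrix n 0 * copairingMatrix n 0
          * ((J⁻¹).transpose * pairingMatrix n u * J⁻¹) := by rw [h4, Matrix.one_mul]
    _ = pairingMatrix n 0 := by rw [Matrix.mul_assoc, h1, Matrix.mul_one]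

theorem flatJacobian_zero : flatJacobian n 0 = 1 := by
  have hg : (genPoly fun j => (0 : Fin (n + 2) → ℂ) j / 2) = 0 := by simp [genPoly]
  have hr : ∀ q, rootPow (2 * ((n : ℂ) + 1)) 0 q = 1 := fun q => by
    rw [rootPow, ← sub_eq_zero, ← subst_one_eq (g := 0) (by simp), ← subst_sub (hasSubst (by simp)),
      subst_zero_of_constantCoeff_zero (by simp)]
  ext γ a
  refine Fin.lastCases ?_ (fun γ => ?_) γ <;> refine Fin.lastCases ?_ (fun a => ?_) a
  · simp [flatJacobian]
  · rw [Matrix.one_apply_ne (Fin.castSucc_lt_last a).ne']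
    simp [flatJacobian]
  · rw [Matrix.one_apply_ne (Fin.castSucc_lt_last γ).ne]
    simp [flatJacobian]
  · simp only [flatJacobian, Matrix.of_apply, Fin.lastCases_castSucc, hg, hr, mul_one, coeff_X_pow,
      Matrix.one_apply, Fin.ext_iff, Fin.val_castSucc]
    simp only [eq_comm]

end

/-! ### The explicit coordinates, their Jacobian and their flatness. -/

theorem hasDerivAt_coeff_pow (g h : PowerSeries ℂ) (r m : ℕ) :
    HasDerivAt (fun τ : ℂ => coeff m ((g + C τ * h) ^ r)) (r * coeff m (h * g ^ (r - 1))) 0 := by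
  induction r generalizing m with
  | zero => simpa using hasDerivAt_const (0 : ℂ) (coeff m (1 : PowerSeries ℂ))
  | succ r ih =>
    have h1 : ∀ j, HasDerivAt (fun τ : ℂ => coeff j (g + C τ * h)) (coeff j h) 0 := by
      intro j
      simp only [map_add, coeff_C_mul]
      simpa using ((hasDerivAt_id (0 : ℂ)).mul_const (coeff j h)).const_add (coeff j g)
    have hfun : (fun τ : ℂ => coeff m ((g + C τ * h) ^ (r + 1))) = fun τ =>
        ∑ p ∈ antidiagonal m, coeff p.1 ((g + C τ * h) ^ r) * coeff p.2 (g + C τ * h) := by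
      funext τ
      rw [pow_succ, coeff_mul]
    rw [hfun]
    refine (HasDerivAt.fun_sum fun (p : ℕ × ℕ) (_ : p ∈ antidiagonal m) =>
      (ih p.1).mul (h1 p.2)).congr_deriv ?_
    simp only [map_zero, zero_mul, add_zero]
    rw [sum_add_distrib, ← coeff_mul]
    have h2 : ∑ p ∈ antidiagonal m, (r : ℂ) * coeff p.1 (h * g ^ (r - 1)) * coeff p.2 g
        = r * coeff m (h * g ^ (r - 1) * g) := by
      rw [coeff_mul, mul_sum]
      exact sum_congr rfl fun p _ => mul_assoc _ _ _
    rw [h2]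
    rcases r with _ | r
    · simp
    · rw [Nat.add_sub_cancel, Nat.add_sub_cancel, mul_assoc, ← pow_succ, mul_comm (g ^ (r + 1)) h]
      push_cast
      ring

theorem hasDerivAt_coeff_subst {g h : PowerSeries ℂ} (hg : constantCoeff g = 0)
    (hh : constantCoeff h = 0) (Y : PowerSeries ℂ) (m : ℕ) :
    HasDerivAt (fun τ : ℂ => coeff m (Y.subst (g + C τ * h) : PowerSeries ℂ))
      (coeff m (h * (derivative ℂ Y).subst g)) 0 := by
  have h0 : ∀ τ : ℂ, constantCoeff (g + C τ * h) = 0 := fun τ => by simp [hg, hh]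
  simp_rw [fun τ => coeff_subst_eq_sum (h0 τ) Y m]
  refine (HasDerivAt.fun_sum fun r (_ : r ∈ range (m + 1)) =>
    (hasDerivAt_coeff_pow g h r m).const_mul (coeff r Y)).congr_deriv ?_
  symm
  -- The shift of index in Y' makes one sum longer by a term, which vanishes because `h` has no
  -- constant term.
  have hlast : coeff m (h * g ^ m) = 0 := by
    have : X ^ (m + 1) ∣ h * g ^ m := by
      rw [pow_succ']
      exact mul_dvd_mul (X_dvd_iff.2 hh) (X_pow_dvd_pow hg m)
    exact X_pow_dvd_iff.1 this m (Nat.lt_succ_self m)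
  rw [coeff_mul_subst hg, sum_range_succ, hlast, mul_zero, add_zero, sum_range_succ']
  simp only [Nat.cast_zero, zero_mul, mul_zero, add_zero]
  refine sum_congr rfl fun i _ => ?_
  rw [coeff_derivative, Nat.add_sub_cancel]
  push_cast
  ring

theorem derivative_binomSeries (c p : ℂ) :
    derivative ℂ (binomSeries c p) = C (-p) * binomSeries c (p + c) := by
  have h1 := binomSeries_ode c p
  have h2 : binomSeries c (-c) * binomSeries c c = 1 := by
    rw [← binomSeries_add, neg_add_cancel, binomSeries_zero]
  rw [binomSeries_neg] at h2
  rw [binomSeries_add, map_neg]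
  linear_combination binomSeries c c * h1 - derivative ℂ (binomSeries c p) * h2

/-- The explicit flat coordinates `T_k(u) = 2 ψ_k(u / 2)`. -/
noncomputable def flatCoord (n : ℕ) (u : Fin (n + 2) → ℂ) : Fin (n + 2) → ℂ :=
  fun k => 2 * psi n (fun j => u j / 2) k

theorem contDiff_dividedMonomial {n : ℕ} (α : Fin (n + 1) → ℕ) :
    ContDiff ℂ ((⊤ : ℕ∞) : WithTop ℕ∞) fun z : Fin (n + 2) → ℂ => dividedMonomial z α := by
  unfold dividedMonomial
  exact contDiff_prod fun k _ => ((contDiff_apply ℂ ℂ k.castSucc).pow _).div_const _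

theorem contDiff_psi (n : ℕ) : ContDiff ℂ ((⊤ : ℕ∞) : WithTop ℕ∞) (psi n) := by
  rw [contDiff_pi]
  intro k
  refine Fin.lastCases ?_ (fun γ => ?_) k
  · simp only [psi_last]
    exact contDiff_apply ℂ ℂ _
  · simp only [psi, Fin.lastCases_castSucc]
    exact ContDiff.sum fun α _ => contDiff_const.mul (contDiff_dividedMonomial α)

theorem contDiff_unfoldingSeries (n : ℕ) (b : Fin (n + 1)) :
    ContDiff ℂ ((⊤ : ℕ∞) : WithTop ℕ∞) fun t => unfoldingSeries n t b := by
  unfold unfoldingSeries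
  exact ContDiff.sum fun α _ => contDiff_const.mul (contDiff_dividedMonomial α)

theorem contDiff_flatCoord (n : ℕ) : ContDiff ℂ ((⊤ : ℕ∞) : WithTop ℕ∞) (flatCoord n) := by
  rw [contDiff_pi]
  intro k
  refine contDiff_const.mul ((contDiff_pi.1 (contDiff_psi n) k).comp ?_)
  exact contDiff_pi.2 fun j => (contDiff_apply ℂ ℂ j).div_const 2

theorem hasDerivAt_line {m : ℕ} {T : (Fin m → ℂ) → (Fin m → ℂ)} {u : Fin m → ℂ}
    (hT : DifferentiableAt ℂ T u) (α a : Fin m) :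
    HasDerivAt (fun τ : ℂ => T (u + τ • Pi.single a 1) α) (jacobianMatrix T u α a) 0 :=
  hasDerivAt_pi.1 (hT.hasFDerivAt.hasLineDerivAt (Pi.single a 1)) α

theorem genPoly_add_single {n : ℕ} (u : Fin (n + 2) → ℂ) (a : Fin (n + 1)) (τ : ℂ) :
    (genPoly fun j => (u + τ • Pi.single a.castSucc (1 : ℂ) : Fin (n + 2) → ℂ) j / 2)
      = genPoly (fun j => u j / 2) + C τ * (C (1 / 2) * X ^ (n + 1 - (a : ℕ))) := by
  have : C τ * (C (1 / 2 : ℂ) * X ^ (n + 1 - (a : ℕ)))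
      = ∑ k : Fin (n + 1), if k = a then C τ * (C (1 / 2) * X ^ (n + 1 - (k : ℕ))) else 0 := by
    rw [sum_ite_eq' univ a, if_pos (mem_univ a)]
  rw [this, genPoly, genPoly, ← sum_add_distrib]
  refine sum_congr rfl fun k _ => ?_
  by_cases h : k = a
  · subst h
    simp [add_mul, div_eq_mul_inv]
    ring
  · have : k.castSucc ≠ a.castSucc := fun h' => h (Fin.castSucc_injective _ h')
    simp [h, this]

theorem genPoly_add_single_last {n : ℕ} (u : Fin (n + 2) → ℂ) (τ : ℂ) :
    (genPoly fun j => (u + τ • Pi.single (Fin.last (n + 1)) (1 : ℂ) : Fin (n + 2) → ℂ) j / 2)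
      = genPoly (fun j => u j / 2) := by
  refine sum_congr rfl fun k _ => ?_
  simp [(Fin.castSucc_lt_last k).ne]

theorem flatCoord_castSucc {n : ℕ} (u : Fin (n + 2) → ℂ) (γ : Fin (n + 1)) {m : ℕ}
    (hm : m + γ = n + 1) : flatCoord n u γ.castSucc = 2 / (2 * (m : ℂ) - 1)
      * coeff m (rootPow (2 * (n + 1)) (genPoly fun j => u j / 2) (2 * m - 1)) := by
  rw [flatCoord, ← psi_castSucc_mul _ γ hm]
  have := two_mul_sub_one_ne_zero m
  field_simp

theorem jacobianMatrix_flatCoord (n : ℕ) (u : Fin (n + 2) → ℂ) :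
    jacobianMatrix (flatCoord n) u = flatJacobian n u := by
  have hd : DifferentiableAt ℂ (flatCoord n) u :=
    (contDiff_flatCoord n).differentiable (by simp) u
  ext γ a
  refine (hasDerivAt_line hd γ a).unique ?_
  refine Fin.lastCases ?_ (fun γ => ?_) γ
  · have h0 : ∀ w, flatCoord n w (Fin.last (n + 1)) = w (Fin.last (n + 1)) := fun w => by
      rw [flatCoord, psi_last]; ring
    simp only [h0]
    have h1 : HasDerivAt (fun τ : ℂ => (u + τ • Pi.single a (1 : ℂ) : Fin (n + 2) → ℂ)
        (Fin.last (n + 1))) (Pi.single (M := fun _ => ℂ) a 1 (Fin.last (n + 1))) 0 := by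
      simp only [Pi.add_apply, Pi.smul_apply, smul_eq_mul]
      simpa using ((hasDerivAt_id (0 : ℂ)).mul_const
        (Pi.single (M := fun _ => ℂ) a 1 (Fin.last (n + 1)))).const_add (u (Fin.last (n + 1)))
    refine h1.congr_deriv ?_
    symm
    refine Fin.lastCases ?_ (fun a => ?_) a
    · simp [flatJacobian]
    · simp [flatJacobian, (Fin.castSucc_lt_last a).ne']
  · obtain ⟨m, hm⟩ : ∃ m, m + (γ : ℕ) = n + 1 := ⟨n + 1 - γ, by omega⟩
    simp only [fun w => flatCoord_castSucc w γ hm]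
    refine Fin.lastCases ?_ (fun a => ?_) a
    · simp only [genPoly_add_single_last]
      refine (hasDerivAt_const (0 : ℂ) _).congr_deriv ?_
      simp [flatJacobian]
    · simp only [genPoly_add_single]
      have hg : constantCoeff (genPoly fun j => u j / 2) = 0 := constantCoeff_genPoly _
      have hX : constantCoeff (C (1 / 2 : ℂ) * X ^ (n + 1 - (a : ℕ))) = 0 := by
        have : n + 1 - (a : ℕ) ≠ 0 := by omega
        simp [this]
      refine ((hasDerivAt_coeff_subst hg hX
        (binomSeries (2 * ((n : ℂ) + 1)) (-(2 * (m : ℂ) - 1))) m).const_mul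
          (2 / (2 * (m : ℂ) - 1))).congr_deriv ?_
      symm
      have hmC : (m : ℂ) + (γ : ℕ) = n + 1 := by exact_mod_cast hm
      -- Differentiation lowers the exponent 2m-1 of P by c, to -(2γ+1) with zero-based γ, and
      -- produces a factor 2m-1; the prefactor 2/(2m-1) then cancels against it and the 1/2 from
      -- u/2.
      have he : -(2 * (m : ℂ) - 1) + 2 * ((n : ℂ) + 1) = -(-(2 * ((γ : ℕ) : ℂ) + 1)) := by
        linear_combination -2 * hmC
      rw [derivative_binomSeries, he, subst_mul (hasSubst hg), subst_C_eq, neg_neg,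
        show ∀ R : PowerSeries ℂ, C (1 / 2 : ℂ) * X ^ (n + 1 - (a : ℕ))
          * (C (2 * (m : ℂ) - 1) * R) = C (1 / 2) * (C (2 * (m : ℂ) - 1)
            * (X ^ (n + 1 - (a : ℕ)) * R)) by intro R; ring, coeff_C_mul, coeff_C_mul]
      simp only [flatJacobian, Matrix.of_apply, Fin.lastCases_castSucc]
      rw [← rootPow, coeff_X_pow_mul', coeff_X_pow_mul']
      have h0 := two_mul_sub_one_ne_zero m
      by_cases h : (γ : ℕ) ≤ a
      · rw [if_pos h, if_pos (by omega), show m - (n + 1 - (a : ℕ)) = a - γ by omega]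
        field_simp
      · rw [if_neg h, if_neg (by omega)]
        simp

theorem psi_zero (n : ℕ) : psi n 0 = 0 := by
  ext k
  refine Fin.lastCases ?_ (fun γ => ?_) k
  · simp
  · simp only [psi, Fin.lastCases_castSucc, Pi.zero_apply]
    refine sum_eq_zero fun α hα => ?_
    rw [mem_multiIndices] at hα
    obtain ⟨k, hk⟩ : ∃ k, α k ≠ 0 := by
      by_contra! h
      simp [h] at hα
      omega
    rw [dividedMonomial, prod_eq_zero (mem_univ k), mul_zero]
    simp [hk]

theorem isFlatCoordinates_flatCoord (n : ℕ) : IsFlatCoordinates n (flatCoord n) where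
  holomorphic := contDiff_flatCoord n
  coordinates u := by
    rw [jacobianMatrix_flatCoord]
    exact isUnit_det_flatJacobian n u
  flat := ⟨pairingMatrix n, isPairing_iff.2 fun _ => rfl, pairingMatrix n 0, fun u => by
    rw [jacobianMatrix_flatCoord, gram_flatJacobian]⟩
  map_zero := by
    have h : (fun j => (0 : Fin (n + 2) → ℂ) j / 2) = 0 := by ext; simp
    ext k
    rw [flatCoord, h, psi_zero]
    simp
  jacobian_zero := by rw [jacobianMatrix_flatCoord, flatJacobian_zero]

/-! ### Uniqueness of normalized flat coordinates. -/

/-- The normalization at the origin forces the constant Gram matrix to be the pairing at u = 0. -/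
theorem IsFlatCoordinates.transpose_mul_mul {n : ℕ}
    {T : (Fin (n + 2) → ℂ) → (Fin (n + 2) → ℂ)} (hT : IsFlatCoordinates n T)
    (u : Fin (n + 2) → ℂ) :
    (jacobianMatrix T u).transpose * pairingMatrix n 0 * jacobianMatrix T u
      = pairingMatrix n u := by
  obtain ⟨η, hη, G, hG⟩ := hT.flat
  have h0 := hG 0
  rw [hT.jacobian_zero, isPairing_iff.1 hη, inv_one, Matrix.transpose_one, Matrix.one_mul,
    Matrix.mul_one] at h0
  have h1 := hG u
  rw [isPairing_iff.1 hη, ← h0] at h1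
  have hJ := hT.coordinates u
  set J := jacobianMatrix T u
  have h2 : J.transpose * (J⁻¹).transpose = 1 := by
    rw [← Matrix.transpose_mul, Matrix.nonsing_inv_mul _ hJ, Matrix.transpose_one]
  calc _ = (J.transpose * (J⁻¹).transpose) * pairingMatrix n u * (J⁻¹ * J) := by
          rw [← h1]; simp only [Matrix.mul_assoc]
    _ = _ := by rw [h2, Matrix.nonsing_inv_mul _ hJ, Matrix.one_mul, Matrix.mul_one]

/-- The unfolding coordinates as functions of the flat coordinates. -/
noncomputable def unfoldingCoord (n : ℕ) (t : Fin (n + 2) → ℂ) : Fin (n + 2) → ℂ :=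
  Fin.lastCases (t (Fin.last (n + 1))) fun b : Fin (n + 1) =>
    2 * unfoldingSeries n (fun j => t j / 2) b

theorem contDiff_unfoldingCoord (n : ℕ) :
    ContDiff ℂ ((⊤ : ℕ∞) : WithTop ℕ∞) (unfoldingCoord n) := by
  rw [contDiff_pi]
  intro k
  refine Fin.lastCases ?_ (fun b => ?_) k
  · simp only [unfoldingCoord, Fin.lastCases_last]
    exact contDiff_apply ℂ ℂ _
  · simp only [unfoldingCoord, Fin.lastCases_castSucc]
    refine contDiff_const.mul ((contDiff_unfoldingSeries n b).comp ?_)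
    exact contDiff_pi.2 fun j => (contDiff_apply ℂ ℂ j).div_const 2

theorem flatCoord_unfoldingCoord (n : ℕ) (t : Fin (n + 2) → ℂ) :
    flatCoord n (unfoldingCoord n t) = t := by
  have h := (eq_psi_iff (fun j => unfoldingCoord n t j / 2) (fun j => t j / 2)).2
    ⟨fun b => by simp [unfoldingCoord], by simp [unfoldingCoord]⟩
  ext k
  rw [flatCoord, ← h k]
  ring

theorem unfoldingCoord_flatCoord (n : ℕ) (u : Fin (n + 2) → ℂ) :
    unfoldingCoord n (flatCoord n u) = u := by
  have h := (eq_psi_iff (fun j => u j / 2) (fun j => flatCoord n u j / 2)).1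
    fun k => by simp [flatCoord]
  ext k
  refine Fin.lastCases ?_ (fun b => ?_) k
  · rw [unfoldingCoord, Fin.lastCases_last]
    have := h.2
    linear_combination -2 * this
  · rw [unfoldingCoord, Fin.lastCases_castSucc, ← h.1 b]
    ring

theorem jacobianMatrix_mulVec {m : ℕ} (T : (Fin m → ℂ) → (Fin m → ℂ)) (u v : Fin m → ℂ) :
    (jacobianMatrix T u).mulVec v = fderiv ℂ T u v := by
  ext α
  conv_rhs => rw [pi_eq_sum_univ' v]
  rw [map_sum, Finset.sum_apply, Matrix.mulVec, dotProduct]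
  refine sum_congr rfl fun a _ => ?_
  rw [map_smul, Pi.smul_apply, smul_eq_mul, jacobianMatrix, Matrix.of_apply, mul_comm]

theorem jacobianMatrix_comp {m : ℕ} {T S : (Fin m → ℂ) → (Fin m → ℂ)} {u : Fin m → ℂ}
    (hT : DifferentiableAt ℂ T (S u)) (hS : DifferentiableAt ℂ S u) :
    jacobianMatrix (T ∘ S) u = jacobianMatrix T (S u) * jacobianMatrix S u := by
  apply Matrix.ext_of_mulVec_single
  intro i
  rw [← Matrix.mulVec_mulVec, jacobianMatrix_mulVec, jacobianMatrix_mulVec, jacobianMatrix_mulVec,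
    fderiv_comp u hT hS]
  rfl

theorem jacobianMatrix_id {m : ℕ} (u : Fin m → ℂ) : jacobianMatrix id u = 1 := by
  apply Matrix.ext_of_mulVec_single
  intro i
  rw [jacobianMatrix_mulVec, Matrix.one_mulVec, fderiv_id]
  rfl

/-- A smooth map preserving a constant nondegenerate symmetric bilinear form, which agrees with the
identity to first order at the origin, is the identity. -/
theorem eq_id_of_isometry {m : ℕ} {R : (Fin m → ℂ) → (Fin m → ℂ)}
    {G : Matrix (Fin m) (Fin m) ℂ} (hsymm : G.transpose = G) (hG : IsUnit G.det)
    (hR : ContDiff ℂ ((⊤ : ℕ∞) : WithTop ℕ∞) R)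
    (h : ∀ t, (jacobianMatrix R t).transpose * G * jacobianMatrix R t = G)
    (h0 : R 0 = 0) (hJ0 : jacobianMatrix R 0 = 1) (t : Fin m → ℂ) : R t = t := by
  have hGform : ∀ x y : Fin m → ℂ, dotProduct x (G.mulVec y) = dotProduct y (G.mulVec x) := by
    intro x y
    rw [Matrix.dotProduct_mulVec, ← Matrix.mulVec_transpose, hsymm, dotProduct_comm]
  have hiso : ∀ t a b, dotProduct (fderiv ℂ R t a) (G.mulVec (fderiv ℂ R t b))
      = dotProduct a (G.mulVec b) := by
    intro t a b
    conv_rhs => rw [← h t]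
    rw [← jacobianMatrix_mulVec, ← jacobianMatrix_mulVec, ← Matrix.mulVec_mulVec,
      ← Matrix.mulVec_mulVec, Matrix.dotProduct_mulVec a, ← Matrix.mulVec_transpose,
      Matrix.transpose_transpose]
  have hR2 : ContDiff ℂ 2 R := hR.of_le (WithTop.coe_le_coe.2 (le_top : (2 : ℕ∞) ≤ ⊤))
  have hd : Differentiable ℂ (fderiv ℂ R) :=
    (hR2.fderiv_right (m := 1) (by norm_num)).differentiable one_ne_zero
  set D := fderiv ℂ (fderiv ℂ R) with hD
  have hline : ∀ t c a, HasDerivAt (fun τ : ℂ => fderiv ℂ R (t + τ • c) a) (D t c a) 0 := by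
    intro t c a
    have := (hd t).hasFDerivAt.hasLineDerivAt c
    exact HasDerivAt.clm_apply (u := fun _ => a) this (hasDerivAt_const _ _)
      |>.congr_deriv (by simp [hD])
  -- Differentiate the isometry identity in the direction `c`.
  have hskew : ∀ t c a b, dotProduct (D t c a) (G.mulVec (fderiv ℂ R t b))
      + dotProduct (fderiv ℂ R t a) (G.mulVec (D t c b)) = 0 := by
    intro t c a b
    have h1 : HasDerivAt (fun τ : ℂ => dotProduct (fderiv ℂ R (t + τ • c) a)
        (G.mulVec (fderiv ℂ R (t + τ • c) b)))
        (∑ i, (D t c a i * G.mulVec (fderiv ℂ R (t + (0 : ℂ) • c) b) i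
          + fderiv ℂ R (t + (0 : ℂ) • c) a i * G.mulVec (D t c b) i)) 0 := by
      refine HasDerivAt.fun_sum fun i _ => (hasDerivAt_pi.1 (hline t c a) i).mul ?_
      change HasDerivAt (fun τ : ℂ => ∑ j, G i j * fderiv ℂ R (t + τ • c) b j)
        (∑ j, G i j * D t c b j) 0
      exact HasDerivAt.fun_sum fun j _ => (hasDerivAt_pi.1 (hline t c b) j).const_mul (G i j)
    simp only [hiso] at h1
    have h2 := h1.unique (hasDerivAt_const _ _)
    rw [sum_add_distrib, zero_smul, add_zero] at h2
    exact h2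
  have hDsymm : ∀ t a b, D t a b = D t b a := fun t a b =>
    (hR2.contDiffAt.isSymmSndFDerivAt (by simp)).eq a b
  -- The trilinear form is symmetric in c, a and skew in a, b, hence zero, as in the uniqueness of
  -- the Levi-Civita connection.
  have hzero : ∀ t c a b, dotProduct (D t c a) (G.mulVec (fderiv ℂ R t b)) = 0 := by
    intro t c a b
    have e1 := hskew t c a b
    have e2 := hskew t a b c
    have e3 := hskew t b c a
    rw [hGform (fderiv ℂ R t _)] at e1 e2 e3
    rw [hDsymm t a b] at e2
    rw [hDsymm t a c] at e2
    rw [hDsymm t b c] at e3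
    have : (2 : ℂ) * dotProduct (D t c a) (G.mulVec (fderiv ℂ R t b)) = 0 := by
      linear_combination e1 + e2 - e3
    simpa using this
  have hDzero : ∀ t, D t = 0 := by
    intro t
    ext1 c
    ext1 a
    have hunit : IsUnit (jacobianMatrix R t).det := by
      have := congrArg Matrix.det (h t)
      rw [Matrix.det_mul] at this
      rw [← this] at hG
      exact isUnit_of_mul_isUnit_right hG
    refine dotProduct_eq_zero _ fun w => ?_
    -- This vector is chosen so that its image under G R'(t) is the arbitrary `w`.
    have h1 := hzero t c a ((jacobianMatrix R t)⁻¹.mulVec (G⁻¹.mulVec w))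
    rwa [← jacobianMatrix_mulVec, Matrix.mulVec_mulVec (M := jacobianMatrix R t),
      Matrix.mul_nonsing_inv _ hunit, Matrix.one_mulVec, Matrix.mulVec_mulVec,
      Matrix.mul_nonsing_inv _ hG, Matrix.one_mulVec] at h1
  have hconst : ∀ t, fderiv ℂ R t = ContinuousLinearMap.id ℂ _ := by
    intro t
    rw [is_const_of_fderiv_eq_zero hd hDzero t 0]
    ext1 v
    rw [← jacobianMatrix_mulVec, hJ0, Matrix.one_mulVec]
    rfl
  have hRd : Differentiable ℂ R := hR.differentiable (by simp)
  have h1 : ∀ t, fderiv ℂ (fun x => R x - x) t = 0 := by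
    intro t
    rw [fderiv_fun_sub (hRd t) differentiableAt_fun_id, hconst, fderiv_fun_id, sub_self]
  have h2 := is_const_of_fderiv_eq_zero (hRd.sub differentiable_fun_id) h1 t 0
  simpa [h0, sub_eq_zero] using h2

/-- Both `T` and `flatCoord n` pull the pairing at 0 back to the pairing at u, so `T` composed with
the polynomial inverse `unfoldingCoord n` is an isometry. -/
theorem IsFlatCoordinates.eq_flatCoord {n : ℕ} {T : (Fin (n + 2) → ℂ) → (Fin (n + 2) → ℂ)}
    (hT : IsFlatCoordinates n T) : T = flatCoord n := by
  have hT0 := isFlatCoordinates_flatCoord n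
  have hS : Differentiable ℂ (unfoldingCoord n) :=
    (contDiff_unfoldingCoord n).differentiable (by simp)
  have hTd : Differentiable ℂ T := hT.holomorphic.differentiable (by simp)
  have hT0d : Differentiable ℂ (flatCoord n) := hT0.holomorphic.differentiable (by simp)
  have hinv : ∀ t, jacobianMatrix (flatCoord n) (unfoldingCoord n t)
      * jacobianMatrix (unfoldingCoord n) t = 1 := by
    intro t
    rw [← jacobianMatrix_comp (hT0d _) (hS _), ← jacobianMatrix_id t]
    congr 1
    exact funext (flatCoord_unfoldingCoord n)
  have hS0 : unfoldingCoord n 0 = 0 := by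
    conv_lhs => rw [← hT0.map_zero, unfoldingCoord_flatCoord]
  have hR : ∀ t, (T ∘ unfoldingCoord n) t = t := by
    apply eq_id_of_isometry (pairingMatrix_transpose n 0) (isUnit_det_pairingMatrix n 0)
      (hT.holomorphic.comp (contDiff_unfoldingCoord n))
    · intro t
      rw [jacobianMatrix_comp (hTd _) (hS _), Matrix.transpose_mul]
      have h1 := hT.transpose_mul_mul (unfoldingCoord n t)
      rw [← hT0.transpose_mul_mul (unfoldingCoord n t)] at h1
      set A := jacobianMatrix T (unfoldingCoord n t)
      set B := jacobianMatrix (unfoldingCoord n) t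
      set E := jacobianMatrix (flatCoord n) (unfoldingCoord n t)
      calc B.transpose * A.transpose * pairingMatrix n 0 * (A * B)
          = B.transpose * (A.transpose * pairingMatrix n 0 * A) * B := by
            simp only [Matrix.mul_assoc]
        _ = (E * B).transpose * pairingMatrix n 0 * (E * B) := by
            rw [h1, Matrix.transpose_mul]; simp only [Matrix.mul_assoc]
        _ = pairingMatrix n 0 := by
            rw [hinv, Matrix.transpose_one, Matrix.one_mul, Matrix.mul_one]
    · rw [Function.comp_apply, hS0, hT.map_zero]
    · have h1 := hinv 0
      rw [hS0, hT0.jacobian_zero, Matrix.one_mul] at h1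
      rw [jacobianMatrix_comp (hTd _) (hS _), hS0, hT.jacobian_zero, h1, Matrix.one_mul]
  funext u
  have := hR (flatCoord n u)
  rwa [Function.comp_apply, unfoldingCoord_flatCoord] at this

end DSing

theorem mainTheorem12 (n : ℕ) :
    (∃! T : (Fin (n + 2) → ℂ) → (Fin (n + 2) → ℂ), DSing.IsFlatCoordinates n T) ∧
    ∀ T : (Fin (n + 2) → ℂ) → (Fin (n + 2) → ℂ), DSing.IsFlatCoordinates n T →
      ∀ v t : Fin (n + 2) → ℂ,
        ((∀ k, t k = T (fun j => 2 * v j) k / 2) ↔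
          ((∀ b : Fin (n + 1), v b.castSucc = DSing.unfoldingSeries n t b) ∧
            v (Fin.last (n + 1)) = t (Fin.last (n + 1)))) ∧
        ((∀ k, t k = T (fun j => 2 * v j) k / 2) ↔ ∀ k, t k = DSing.psi n v k) := by
  refine ⟨⟨DSing.flatCoord n, DSing.isFlatCoordinates_flatCoord n, fun T hT => hT.eq_flatCoord⟩, ?_⟩
  intro T hT v t
  have h : ∀ k, T (fun j => 2 * v j) k / 2 = DSing.psi n v k := by
    intro k
    rw [hT.eq_flatCoord, DSing.flatCoord]
    simp
  simp only [h, and_true, DSing.eq_psi_iff v t]
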